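/- **Conventions.** Let $[q]=\{1,\dots,q\}$, and let $\mathrm{Inc}^q(2\times c)$ be the set of fillings $T$ of the $2\times c$ rectangle with elements of $[q]$ that strictly increase along rows (left to right) and down columns. *$K$-gromotion.* For a filling with entries in a finite alphabet $\mathcal A=(a_1<\dots<a_n)$, $K$-gromotion is the following procedure. First replace the entry $a_1$, wherever it occurs, by the symbol $\bullet$. Then for $i=2,\dots,n$ in this order: let $\mathfrak B$ be the set of boxes containing $\bullet$ and $\mathfrak C$ the set of boxes with entry $a_i$ adjacent to a box in $\mathfrak B$; fill all boxes of $\mathfrak C$ with $\bullet$ and, simultaneously, all boxes of $\mathfrak B$ adjacent to a box in $\mathfrak C$ with $a_i$. Finally replace every $\bullet$ by $a_1$. The result is regarded as a filling over the alphabet $(a_2<\dots<a_n<a_1)$, so that the procedure can be iterated; write $\mathcal G^k(T)$ for its $k$-th iterate starting from $T$ and the alphabet $(1<2<\dots<q)$. We say that $\beta$ *moves from row $2$ to row $1$* if, in the iteration for the letter $\beta$, some box $\mathsf b\in\mathfrak B$ of row $1$ gets filled with $\beta$ while the box immediately below $\mathsf b$ lies in $\mathfrak C$ and gets filled with $\bullet$.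 *Promotion digraph.* $\mathsf{prom}_1(T)$ is the directed graph with vertex set $[q]$ that has an arrow $\alpha\to\beta$ exactly when $\beta$ moves from row $2$ to row $1$ in the application of $K$-gromotion to $\mathcal G^{\alpha-1}(T)$. *The partition $\pi(T)$.* A set partition of $[q]$ is noncrossing if there are no $a<b<c<d$ with $a,c$ in one block and $b,d$ in a different block. A block is nontrivial if it has at least two elements. **Theorem.** Let $T\in\mathrm{Inc}^q(2\times c)$. There is a unique noncrossing set partition $\pi(T)$ of $[q]$ such that, for each $i\in[q]$, - $\{i\}$ is a block if and only if $i$ does not appear in $T$; - $i$ is the least element of a nontrivial block if and only if $i$ appears only in the top row of $T$; - $i$ is the greatest element of a nontrivial block if and only if $i$ appears only in the bottom row of $T$; - if $i$ appears in both rows of $T$, then $i$ is neither least nor greatest in its block. Moreover, $\mathsf{prom}_1(T)$ is the disjoint union of the (loopless) complete digraphs on the blocks of $\pi(T)$: for all $u,v\in[q]$ there is an arrow $u\to v$ in $\mathsf{prom}_1(T)$ if and only if $u\neq v$ and $u,v$ lie in the same block of $\pi(T)$. -/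

import Mathlib

namespace KPromotion

/-- The boxes of the `r × c` rectangle: `(i, j)` is the box in the (zero-based) row `i`, counted
from the top, and the (zero-based) column `j`, counted from the left. -/
abbrev Box (r c : ℕ) : Type := Fin r × Fin c

/-- `Inc^q(r × c)`: fillings of the `r × c` rectangle by letters of `[q]`, strictly increasing
along rows (left to right) and down columns. The letter `v ∈ {1, …, q}` is represented by the
element of `Fin q` with value `v - 1`. -/
structure IncTableau (r c q : ℕ) where
  entry : Box r c → Fin q
  row_strict : ∀ (i : Fin r) (j j' : Fin c), j < j' → entry (i, j) < entry (i, j')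
  col_strict : ∀ (i i' : Fin r) (j : Fin c), i < i' → entry (i, j) < entry (i', j)

/-- Two boxes are adjacent when they share an edge. -/
abbrev Adjacent {r c : ℕ} (b b' : Box r c) : Prop :=
  (b.1 = b'.1 ∧ (b.2.val + 1 = b'.2.val ∨ b'.2.val + 1 = b.2.val)) ∨
  (b.2 = b'.2 ∧ (b.1.val + 1 = b'.1.val ∨ b'.1.val + 1 = b.1.val))

/- Fillings in which some boxes hold the symbol `•` are functions `Box r c → Option α`, with
`none` for `•`. A finite alphabet `a₁ < a₂ < ⋯ < aₙ` is the list `[a₁, a₂, …, aₙ]` of its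
letters in increasing order. -/

section Gromotion

variable {r c : ℕ} {α : Type*} [DecidableEq α]

/-- First step of `K`-gromotion: replace the entry `a` by `•`. -/
def deleteLetter (a : α) (F : Box r c → α) : Box r c → Option α :=
  fun b => if F b = a then none else some (F b)

/-- One iteration, for the letter `a`, of the sliding step of `K`-gromotion: simultaneously, each
box with `•` that is adjacent to a box with entry `a` gets filled with `a`, and each box with
entry `a` that is adjacent to a box with `•` gets filled with `•`. -/
def slide (S : Box r c → Option α) (a : α) : Box r c → Option α := fun b =>
  if S b = none ∧ ∃ b', Adjacent b b' ∧ S b' = some a then some a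
  else if S b = some a ∧ ∃ b', Adjacent b b' ∧ S b' = none then none
  else S b

/-- `K`-gromotion of a filling over the alphabet `a₁ < a₂ < ⋯ < aₙ`: delete `a₁`, perform the
sliding step for `a₂, …, aₙ` in this order, and finally replace every `•` by `a₁`. -/
def gromotion : List α → (Box r c → α) → (Box r c → α)
  | [], F => F
  | a :: as, F => fun b => (as.foldl slide (deleteLetter a F) b).getD a

/-- `β` moves from row `i + 1` to row `i` (rows numbered from `1`) during the `K`-gromotion of `F`:
in the iteration of the sliding step for the letter `β`, some box `b` of row `i` that holds `•`
gets filled with `β`, and the box `b'` immediately below `b`, which holds `β`, gets filled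
with `•`. -/
def MovesUp : List α → (Box r c → α) → ℕ → α → Prop
  | [], _, _, _ => False
  | a :: as, F, i, β => ∃ as₁ as₂ : List α, as = as₁ ++ β :: as₂ ∧
      ∃ b b' : Box r c, b.1.val + 1 = i ∧ b'.1.val = i ∧ b'.2 = b.2 ∧
        (let S := as₁.foldl slide (deleteLetter a F)
         S b = none ∧ slide S β b = some β ∧ S b' = some β ∧ slide S β b' = none)

end Gromotion

/-- The alphabet `grow^k (1 < 2 < ⋯ < q)`, where `grow (a₁ < ⋯ < aₙ) = (a₂ < ⋯ < aₙ < a₁)`. -/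
def alphabet (q k : ℕ) : List (Fin q) := (List.finRange q).rotate k

/-- The `k`-fold iterate of `K`-gromotion applied to `T ∈ Inc^q(r × c)`; it is a filling over the
alphabet `grow^k (1 < 2 < ⋯ < q)`. -/
def gromotionIter {r c q : ℕ} (T : IncTableau r c q) : ℕ → (Box r c → Fin q)
  | 0 => T.entry
  | k + 1 => gromotion (alphabet q k) (gromotionIter T k)

/-- The `i`-th promotion digraph of `T ∈ Inc^q(r × c)`, on the vertex set `[q]`: there is an arrow
`u → v` when `v` moves from row `i + 1` to row `i` in the application of `K`-gromotion to the
`(u - 1)`-st `K`-gromotion of `T`. (The letter `u` has value `u - 1` in `Fin q`.) -/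
def prom {r c q : ℕ} (i : ℕ) (T : IncTableau r c q) : Digraph (Fin q) where
  Adj u v := MovesUp (alphabet q u.val) (gromotionIter T u.val) i v

/-- The complete digraph on the vertices in `B` (no loops), as a digraph on `V`. -/
def completeOn {V : Type*} (B : Finset V) : Digraph V where
  Adj u v := u ∈ B ∧ v ∈ B ∧ u ≠ v

/-- A set partition of `[q]` is noncrossing when there are no `a < b < c < d` with `a, c` in one
block and `b, d` in a different block. -/
def IsNoncrossing {q : ℕ} (π : Finpartition (Finset.univ : Finset (Fin q))) : Prop :=
  ∀ B ∈ π.parts, ∀ B' ∈ π.parts, ∀ a b c d : Fin q, a < b → b < c → c < d →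
    a ∈ B → c ∈ B → b ∈ B' → d ∈ B' → B = B'

/-- The letter `v` appears in the (zero-based) row `i` of `T`. -/
def AppearsInRow {r c q : ℕ} (T : IncTableau r c q) (i : Fin r) (v : Fin q) : Prop :=
  ∃ j : Fin c, T.entry (i, j) = v

/-- `π` is the noncrossing set partition `π(T)` corresponding to `T ∈ Inc^q(2 × c)`. -/
structure IsPartitionOf {c q : ℕ} (T : IncTableau 2 c q)
    (π : Finpartition (Finset.univ : Finset (Fin q))) : Prop where
  noncrossing : IsNoncrossing π
  singleton_iff : ∀ v : Fin q,
    {v} ∈ π.parts ↔ ¬ AppearsInRow T 0 v ∧ ¬ AppearsInRow T 1 v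
  least_iff : ∀ v : Fin q,
    (∃ B ∈ π.parts, 1 < B.card ∧ IsLeast (B : Set (Fin q)) v) ↔
      AppearsInRow T 0 v ∧ ¬ AppearsInRow T 1 v
  greatest_iff : ∀ v : Fin q,
    (∃ B ∈ π.parts, 1 < B.card ∧ IsGreatest (B : Set (Fin q)) v) ↔
      ¬ AppearsInRow T 0 v ∧ AppearsInRow T 1 v
  middle : ∀ v : Fin q, AppearsInRow T 0 v → AppearsInRow T 1 v →
    ∀ B ∈ π.parts, v ∈ B →
      ¬ IsLeast (B : Set (Fin q)) v ∧ ¬ IsGreatest (B : Set (Fin q)) v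

end KPromotion

/-! Letters are numbered from `0`. Let `x` and `y` be the rows of `T`, continued by letters from `q`
on, and suppose `x 0 = 0`. In one `K`-gromotion the bullet runs right along the top row as long as
`x (j + 1) ≤ y j`. At a tie `x (j + 1) = y j` it also drops to the bottom row, and in the first
column `s` with `y s < x (s + 1)` it only drops. So the letters that move up are the `y j` with `y j
≤ x (j + 1)` and `x (i + 1) ≤ y i` for all `i < j` (`movesUp_twoRows_iff`).

On the other side, the tableau is a Motzkin path: up at letters of the top row only, down at letters
of the bottom row only, flat otherwise. Its blocks form a noncrossing partition in which the top row
consists of the elements that are not greatest, and the bottom row of those that are not least, in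
their block. The block of `0` consists of `0` and the bottom letters met at height one before the
path returns to height zero. In terms of `x` and `y` this is the condition above (`link_zero_iff`),
so the arrows out of `0` are as claimed.

The other arrows follow by rotation. After renaming the alphabet, the new filling is again a
tableau, and its relation is the old one with every letter lowered by one cyclically
(`IsNoncrossingRel.shift`, `gromotion_step`). Hence the arrows out of `u` are the arrows out of `0`
for the `u`-th iterate (`prom_adj_iff`). Uniqueness holds because a noncrossing relation is
determined by its non-greatest and non-least elements (`IsNoncrossingRel.rel_iff`); this also
identifies any such relation with that of the path. -/

namespace KPromotion

/-! ### Slides described by initial and final fillings -/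

/-- The filling of the `2 × c` rectangle with rows `x` and `y`. -/
def ofRows {α : Type*} (c : ℕ) (x y : ℕ → α) : Box 2 c → α :=
  fun b => if b.1 = 0 then x b.2 else y b.2

@[simp] lemma ofRows_zero {α : Type*} (c : ℕ) (x y : ℕ → α) (j : Fin c) :
    ofRows c x y (0, j) = x j := by simp [ofRows]

@[simp] lemma ofRows_one {α : Type*} (c : ℕ) (x y : ℕ → α) (j : Fin c) :
    ofRows c x y (1, j) = y j := by simp [ofRows]

/-- The intermediate filling in which the letters below `t` have reached their final positions,
given by `G`, while the letters from `t` on are still in their initial positions, given by `F`. -/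
def slideState {β : Type*} (F G : β → ℕ) (t : ℕ) (b : β) : Option ℕ :=
  if G b < t then some (G b) else if F b < t then none else some (F b)

section slideState
variable {β : Type*} {F G : β → ℕ}

lemma slideState_eq_none {t : ℕ} {b : β} : slideState F G t b = none ↔ F b < t ∧ t ≤ G b := by
  unfold slideState; split_ifs <;> simp <;> omega

lemma slideState_eq_some (h : ∀ b, F b ≤ G b) {t : ℕ} {b : β} :
    slideState F G t b = some t ↔ F b = t := by
  have := h b
  unfold slideState; split_ifs <;> simp <;> omega

end slideState

/-- A box holds `F b`, then a bullet while `F b < t ≤ G b`, then `G b`. Hence a guessed final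
filling `G` can be verified locally: at time `t` a bullet must have a neighbour `t` exactly when it
is due to receive `t`, and a letter `t` must have a bullet as neighbour exactly when it is due to
leave. -/
lemma slide_slideState {r c : ℕ} {F G : Box r c → ℕ} {t : ℕ} (hFG : ∀ b, F b ≤ G b)
    (hbullet : ∀ b, F b < t → t ≤ G b → ((∃ b', Adjacent b b' ∧ F b' = t) ↔ G b = t))
    (hletter : ∀ b, F b = t →
      ((∃ b', Adjacent b b' ∧ F b' < t ∧ t ≤ G b') ↔ F b < G b)) :
    slide (slideState F G t) t = slideState F G (t + 1) := by
  funext b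
  have h1 := hbullet b
  have h2 := hletter b
  have h3 := hFG b
  simp only [slide, slideState_eq_none, slideState_eq_some hFG]
  by_cases hb : F b < t ∧ t ≤ G b
  · have := h1 hb.1 hb.2
    by_cases hG : G b = t
    · rw [if_pos ⟨hb, this.2 hG⟩]
      unfold slideState; rw [if_pos (by omega), hG]
    · rw [if_neg (fun h => hG (this.1 h.2)), if_neg (fun h => by omega)]
      unfold slideState
      rw [if_neg (by omega), if_pos (by omega), if_neg (by omega), if_pos (by omega)]
  · rw [if_neg (fun h => hb h.1)]
    by_cases hF : F b = t
    · have := h2 hF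
      by_cases hlt : F b < G b
      · rw [if_pos ⟨hF, this.2 hlt⟩]
        unfold slideState
        rw [if_neg (by omega), if_pos (by omega)]
      · rw [if_neg (fun h => hlt (this.1 h.2))]
        unfold slideState
        rw [if_neg (by omega), if_neg (by omega), if_pos (by omega)]
        congr 1; omega
    · rw [if_neg (fun h => hF h.1)]
      unfold slideState
      split_ifs <;> first | rfl | omega

/-! ### One `K`-gromotion of a two-row filling -/

section TwoRows

/-- The top row of the `K`-gromotion of the tableau with rows `x` and `y`. -/
def newTop (x y : ℕ → ℕ) (s : ℕ) (j : ℕ) : ℕ :=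
  if j < s then x (j + 1) else if j = s then y j else x j

/-- The bottom row of the `K`-gromotion of the tableau with rows `x` and `y`. -/
def newBot (y : ℕ → ℕ) (r : ℕ) (j : ℕ) : ℕ :=
  if j < r then y j else y (j + 1)

/-- Two infinite rows, strictly increasing along rows and down columns, whose entries below `q`
are those in the first `c` columns. -/
structure IsRows (c q : ℕ) (x y : ℕ → ℕ) : Prop where
  xmono : StrictMono x
  ymono : StrictMono y
  lt : ∀ j, x j < y j
  x_ge : ∀ j, c ≤ j → q ≤ x j
  y_lt : ∀ j, j < c → y j < q

/-- In column `s` the bullet of the top row last moves down, and in column `r` it first does. -/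
structure IsTurn (x y : ℕ → ℕ) (r s : ℕ) : Prop where
  before_s : ∀ i < s, x (i + 1) ≤ y i
  at_s : y s < x (s + 1)
  before_r : ∀ i < r, x (i + 1) < y i
  at_r : y r ≤ x (r + 1)

variable {c q r s : ℕ} {x y : ℕ → ℕ}

lemma IsTurn.le (h : IsTurn x y r s) : r ≤ s := by
  by_contra! hlt
  have := h.before_r s hlt
  have := h.at_s
  omega

lemma IsTurn.exists (h : IsRows c q x y) (hc : 0 < c) : ∃ r s, IsTurn x y r s := by
  classical
  have h0 : y (c - 1) < x (c - 1 + 1) :=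
    (h.y_lt _ (by omega)).trans_le (h.x_ge _ (by omega))
  have hs : ∃ j, y j < x (j + 1) := ⟨_, h0⟩
  have hr : ∃ j, y j ≤ x (j + 1) := ⟨_, h0.le⟩
  exact ⟨Nat.find hr, Nat.find hs, fun i hi => not_lt.1 (Nat.find_min hs hi), Nat.find_spec hs,
    fun i hi => not_le.1 (Nat.find_min hr hi), Nat.find_spec hr⟩

lemma IsTurn.lt (ht : IsTurn x y r s) (h : IsRows c q x y) (hc : 0 < c) : s < c := by
  by_contra! hlt
  have h1 := ht.before_s (c - 1) (by omega)
  have h2 := h.y_lt (c - 1) (by omega)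
  have h3 := h.x_ge (c - 1 + 1) (by omega)
  omega

lemma le_newTop (h : IsRows c q x y) (j : ℕ) : x j ≤ newTop x y s j := by
  have := h.lt j
  have := h.xmono (Nat.lt_add_one j)
  unfold newTop; split_ifs <;> omega

lemma le_newBot (h : IsRows c q x y) (j : ℕ) : y j ≤ newBot y r j := by
  have := h.ymono (Nat.lt_add_one j)
  unfold newBot; split_ifs <;> omega

lemma exists_adjacent_top {p : Box 2 c → Prop} (j : Fin c) :
    (∃ b', Adjacent (0, j) b' ∧ p b') ↔
      p (1, j) ∨ (∃ k : Fin c, k.val + 1 = j.val ∧ p (0, k)) ∨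
        ∃ k : Fin c, k.val = j.val + 1 ∧ p (0, k) := by
  constructor
  · rintro ⟨⟨i, k⟩, ha, hp⟩
    fin_cases i
    · simp [Adjacent] at ha hp
      rcases ha with ha | ha
      · exact Or.inr (Or.inr ⟨k, ha.symm, hp⟩)
      · exact Or.inr (Or.inl ⟨k, ha, hp⟩)
    · simp [Adjacent] at ha hp
      subst ha
      exact Or.inl hp
  · rintro (hp | ⟨k, hk, hp⟩ | ⟨k, hk, hp⟩)
    · exact ⟨_, by simp [Adjacent], hp⟩
    · exact ⟨_, by simp [Adjacent, hk], hp⟩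
    · exact ⟨_, by simp [Adjacent, hk], hp⟩

lemma exists_adjacent_bot {p : Box 2 c → Prop} (j : Fin c) :
    (∃ b', Adjacent (1, j) b' ∧ p b') ↔
      p (0, j) ∨ (∃ k : Fin c, k.val + 1 = j.val ∧ p (1, k)) ∨
        ∃ k : Fin c, k.val = j.val + 1 ∧ p (1, k) := by
  constructor
  · rintro ⟨⟨i, k⟩, ha, hp⟩
    fin_cases i
    · simp [Adjacent] at ha hp
      subst ha
      exact Or.inl hp
    · simp [Adjacent] at ha hp
      rcases ha with ha | ha
      · exact Or.inr (Or.inr ⟨k, ha.symm, hp⟩)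
      · exact Or.inr (Or.inl ⟨k, ha, hp⟩)
  · rintro (hp | ⟨k, hk, hp⟩ | ⟨k, hk, hp⟩)
    · exact ⟨_, by simp [Adjacent], hp⟩
    · exact ⟨_, by simp [Adjacent, hk], hp⟩
    · exact ⟨_, by simp [Adjacent, hk], hp⟩

lemma ofRows_le (h : IsRows c q x y) (b : Box 2 c) :
    ofRows c x y b ≤ ofRows c (newTop x y s) (newBot y r) b := by
  obtain ⟨i, j⟩ := b
  fin_cases i
  · simpa using le_newTop h j
  · simpa using le_newBot h j

/-- The local conditions are checked for bullets and letters in each row. Neighbours on the wrong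
side are excluded by strictness of rows and columns; the inequalities of `IsTurn` decide between
moving right and moving down. -/
lemma slide_twoRows (h : IsRows c q x y) (ht : IsTurn x y r s) (h0 : x 0 = 0)
    {t : ℕ} (ht0 : 0 < t) (htq : t < q) :
    slide (slideState (ofRows c x y) (ofRows c (newTop x y s) (newBot y r)) t) t =
      slideState (ofRows c x y) (ofRows c (newTop x y s) (newBot y r)) (t + 1) := by
  have hrs := ht.le
  apply slide_slideState (ofRows_le h)
  · rintro ⟨i, j⟩
    fin_cases i
    · simp only [Fin.zero_eta, ofRows_zero]
      intro h1 h2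
      rw [exists_adjacent_top]
      simp only [ofRows_zero, ofRows_one]
      have hxj := h.xmono (Nat.lt_add_one j.val)
      constructor
      · rintro (h3 | ⟨k, hk, h3⟩ | ⟨k, hk, h3⟩)
        · unfold newTop at h2 ⊢
          split_ifs at h2 ⊢ with hs hs
          -- A letter `t` below a bullet left of column `s` forces a tie: `x (j + 1) ≤ y j = t ≤ x
          -- (j + 1)`.
          · have := ht.before_s j hs; omega
          · omega
          · omega
        · have := h.xmono (show k.val < j.val by omega); omega
        · rw [hk] at h3
          unfold newTop at h2 ⊢
          split_ifs at h2 ⊢ with hs hs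
          · omega
          · have := ht.at_s; rw [hs] at h2 h3; omega
          · omega
      · intro h3
        unfold newTop at h3
        split_ifs at h3 with hs hs
        · have : j.val + 1 < c := by
            by_contra! hc
            have := h.x_ge _ hc; omega
          exact Or.inr (Or.inr ⟨⟨j + 1, this⟩, rfl, h3⟩)
        · exact Or.inl h3
        · omega
    · simp only [Fin.mk_one, ofRows_one]
      intro h1 h2
      rw [exists_adjacent_bot]
      simp only [ofRows_zero, ofRows_one]
      have := h.lt j
      constructor
      · rintro (h3 | ⟨k, hk, h3⟩ | ⟨k, hk, h3⟩)
        · omega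
        · have := h.ymono (show k.val < j.val by omega); omega
        · rw [hk] at h3
          unfold newBot at h2 ⊢
          split_ifs at h2 ⊢ with hr
          · omega
          · omega
      · intro h3
        unfold newBot at h3
        split_ifs at h3 with hr
        · omega
        · have : j.val + 1 < c := by
            by_contra! hc
            have := h.x_ge _ hc
            have := h.lt (j.val + 1); omega
          exact Or.inr (Or.inr ⟨⟨j + 1, this⟩, rfl, h3⟩)
  · rintro ⟨i, j⟩
    fin_cases i
    · simp only [Fin.zero_eta, ofRows_zero]
      intro h1
      rw [exists_adjacent_top]
      simp only [ofRows_zero, ofRows_one]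
      have hlt := h.lt j
      constructor
      · rintro (h3 | ⟨k, hk, h3⟩ | ⟨k, hk, h3⟩)
        · omega
        · by_contra! h4
          -- Right of column `s` the top row is fixed, and the bullet of column `s` is filled with
          -- `y s` before `x (s + 1)` has its turn.
          have : s < j.val := by
            by_contra! h5
            unfold newTop at h4
            have := h.xmono (Nat.lt_add_one j.val)
            split_ifs at h4 <;> omega
          have h6 := ht.at_s
          unfold newTop at h3
          split_ifs at h3 with h7 h7
          · omega
          · rw [h7] at h3 hk; rw [hk] at h6; omega
          · omega
        · have := h.xmono (show j.val < k.val by omega); omega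
      · intro h3
        have hj : 0 < j.val := by
          by_contra! h4
          have : j.val = 0 := by omega
          rw [this] at h1; omega
        have hjs : j.val ≤ s := by
          by_contra! h4
          unfold newTop at h3
          rw [if_neg (by omega), if_neg (by omega)] at h3; omega
        refine Or.inr (Or.inl ⟨⟨j - 1, by omega⟩, by simp; omega, ?_, ?_⟩)
        · rw [← h1]; exact h.xmono (by simp; omega)
        · simp only [newTop]
          rw [if_pos (by omega), show j.val - 1 + 1 = j.val by omega, h1]
    · simp only [Fin.mk_one, ofRows_one]
      intro h1
      rw [exists_adjacent_bot]
      simp only [ofRows_zero, ofRows_one]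
      have hlt := h.lt j
      have hy := h.ymono (Nat.lt_add_one j.val)
      have key : y j < newBot y r j ↔ r ≤ j := by
        unfold newBot; split_ifs <;> omega
      rw [key]
      constructor
      · rintro (h3 | ⟨k, hk, h3⟩ | ⟨k, hk, h3⟩)
        -- Left of column `r` the top box has received `x (j + 1)` before the turn of `y j`.
        · by_contra! h4
          have := ht.before_r j h4
          unfold newTop at h3
          rw [if_pos (by omega)] at h3
          omega
        · unfold newBot at h3
          split_ifs at h3 <;> omega
        · have := h.ymono (show j.val < k.val by omega); omega
      · intro h3
        rcases h3.eq_or_lt with h3 | h3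
        · have h4 := ht.at_r
          refine Or.inl ⟨by omega, ?_⟩
          unfold newTop
          rw [h3] at h4
          split_ifs <;> omega
        · refine Or.inr (Or.inl ⟨⟨j - 1, by omega⟩, by simp; omega, ?_, ?_⟩)
          · rw [← h1]; exact h.ymono (by simp; omega)
          · simp only [newBot]
            rw [if_neg (by omega), show j.val - 1 + 1 = j.val by omega, h1]

lemma newTop_pos (h : IsRows c q x y) (j : ℕ) : 0 < newTop x y s j := by
  have h1 := h.xmono (Nat.lt_add_one j)
  have h2 := h.lt j
  unfold newTop
  split_ifs with h3 h4
  · omega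
  · omega
  · have := h.xmono (show 0 < j by omega); omega

lemma newBot_pos (h : IsRows c q x y) (j : ℕ) : 0 < newBot y r j := by
  have h2 := h.lt j
  have := le_newBot (r := r) h j
  omega

lemma foldl_slide_twoRows (h : IsRows c q x y) (ht : IsTurn x y r s) (h0 : x 0 = 0) (m : ℕ)
    (hm : m < q) :
    (List.range' 1 m).foldl slide (deleteLetter 0 (ofRows c x y)) =
      slideState (ofRows c x y) (ofRows c (newTop x y s) (newBot y r)) (m + 1) := by
  induction m with
  | zero =>
    funext b
    have hpos : 0 < ofRows c (newTop x y s) (newBot y r) b := by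
      unfold ofRows
      split_ifs
      exacts [newTop_pos h _, newBot_pos h _]
    simp only [List.range'_zero, List.foldl_nil, deleteLetter, slideState, Nat.zero_add,
      Nat.lt_one_iff, if_neg hpos.ne']
  | succ m ih =>
    rw [List.range'_concat, List.foldl_append, ih (by omega)]
    simpa [Nat.add_comm] using slide_twoRows h ht h0 (t := m + 1) (by omega) hm

lemma range_eq_zero_cons (hq : 0 < q) : List.range q = 0 :: List.range' 1 (q - 1) := by
  obtain ⟨q, rfl⟩ := Nat.exists_eq_succ_of_ne_zero hq.ne'
  simp [List.range_eq_range', List.range'_succ]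

/-- A value from `q` on belongs to the artificial continuation of the rows: such a box still holds a
bullet after the last slide, and so receives `0`. -/
lemma gromotion_twoRows (h : IsRows c q x y) (ht : IsTurn x y r s) (h0 : x 0 = 0) (hq : 0 < q)
    (b : Box 2 c) :
    gromotion (List.range q) (ofRows c x y) b =
      if ofRows c (newTop x y s) (newBot y r) b < q then
        ofRows c (newTop x y s) (newBot y r) b else 0 := by
  rw [range_eq_zero_cons hq, gromotion, foldl_slide_twoRows h ht h0 _ (by omega)]
  have : ofRows c x y b < q := by
    have h1 := h.lt b.2
    have h2 := h.y_lt b.2 b.2.2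
    unfold ofRows
    split_ifs <;> omega
  rw [show q - 1 + 1 = q by omega]
  unfold slideState
  beta_reduce
  split_ifs <;> rfl

/-- The letters of the alphabet are distinct, so the slides performed before the one for `v` are
those for `1, …, v - 1`. -/
lemma movesUp_range_iff {r c q i v : ℕ} (hq : 0 < q) {F : Box r c → ℕ} :
    MovesUp (List.range q) F i v ↔ 0 < v ∧ v < q ∧
      ∃ b b' : Box r c, b.1.val + 1 = i ∧ b'.1.val = i ∧ b'.2 = b.2 ∧
        (let S := (List.range' 1 (v - 1)).foldl slide (deleteLetter 0 F)
         S b = none ∧ slide S v b = some v ∧ S b' = some v ∧ slide S v b' = none) := by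
  rw [range_eq_zero_cons hq, MovesUp]
  constructor
  · rintro ⟨as₁, as₂, h, hb⟩
    rw [List.range'_eq_append_iff] at h
    obtain ⟨k, hk, rfl, h⟩ := h
    rw [eq_comm, List.range'_eq_cons_iff] at h
    obtain ⟨h1, h2, -⟩ := h
    obtain rfl : v = k + 1 := by omega
    exact ⟨by omega, by omega, hb⟩
  · rintro ⟨h0, hv, hb⟩
    refine ⟨_, List.range' (v + 1) (q - 1 - v), ?_, hb⟩
    rw [List.range'_eq_append_iff]
    refine ⟨v - 1, by omega, rfl, ?_⟩
    rw [eq_comm, List.range'_eq_cons_iff]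
    refine ⟨by omega, by omega, ?_⟩
    congr 1
    omega

/-- If the final top letter of column `j` is `y j`, the top box holds a bullet when `y j` has its
turn, whether or not the same letter also arrives from the right. The box below then does become a
bullet, since `r ≤ j`. -/
lemma movesUp_twoRows_iff (h : IsRows c q x y) (ht : IsTurn x y r s) (h0 : x 0 = 0) (hq : 0 < q)
    {v : ℕ} :
    MovesUp (List.range q) (ofRows c x y) 1 v ↔ v < q ∧ ∃ j, newTop x y s j = v ∧ y j = v := by
  rw [movesUp_range_iff hq]
  constructor
  · rintro ⟨hv0, hv, ⟨i, j⟩, ⟨i', j'⟩, hi, hi', hj, hS⟩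
    obtain rfl : i = 0 := by ext; simpa using hi
    obtain rfl : i' = 1 := by ext; simpa using hi'
    obtain rfl : j' = j := hj
    rw [foldl_slide_twoRows h ht h0 _ (by omega), show v - 1 + 1 = v by omega] at hS
    simp only [slide_twoRows h ht h0 hv0 hv, slideState_eq_none, slideState_eq_some (ofRows_le h),
      ofRows_zero, ofRows_one] at hS
    obtain ⟨h1, h2, h3, h4⟩ := hS
    refine ⟨hv, j', ?_, h3⟩
    unfold slideState at h2
    simp only [ofRows_zero] at h2
    split_ifs at h2
    · simpa using h2
    · simp at h2; omega
  · rintro ⟨hv, j, h1, h2⟩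
    have hv0 : 0 < v := by have := h.lt j; omega
    have hjc : j < c := by
      by_contra! hc
      have := h.x_ge j hc
      have := h.lt j; omega
    refine ⟨hv0, hv, (0, ⟨j, hjc⟩), (1, ⟨j, hjc⟩), rfl, rfl, rfl, ?_⟩
    rw [foldl_slide_twoRows h ht h0 _ (by omega), show v - 1 + 1 = v by omega]
    simp only [slide_twoRows h ht h0 hv0 hv, slideState_eq_none, slideState_eq_some (ofRows_le h),
      ofRows_zero, ofRows_one]
    have hlt := h.lt j
    have hy := h.ymono (Nat.lt_add_one j)
    refine ⟨by omega, ?_, h2, by omega, ?_⟩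
    · unfold slideState
      simp [h1]
    · have hjr : r ≤ j := by
        by_contra! hr
        have h3 := ht.before_r j hr
        have := ht.le
        unfold newTop at h1
        rw [if_pos (by omega)] at h1
        omega
      unfold newBot
      rw [if_neg (by omega)]; omega

lemma foldl_slide_of_no_bullet {r c : ℕ} {α : Type*} [DecidableEq α] (as : List α)
    (F : Box r c → α) : as.foldl slide (fun b => some (F b)) = fun b => some (F b) := by
  induction as with
  | nil => rfl
  | cons a as ih =>
    have : slide (fun b => some (F b)) a = fun b => some (F b) := by
      funext b
      simp [slide]
    rw [List.foldl_cons, this, ih]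

lemma deleteLetter_of_notMem {r c : ℕ} {α : Type*} [DecidableEq α] {a : α}
    {F : Box r c → α} (h : ∀ b, F b ≠ a) : deleteLetter a F = fun b => some (F b) := by
  funext b
  simp [deleteLetter, h b]

lemma gromotion_of_notMem {r c : ℕ} {α : Type*} [DecidableEq α] {a : α} {as : List α}
    {F : Box r c → α} (h : ∀ b, F b ≠ a) : gromotion (a :: as) F = F := by
  funext b
  rw [gromotion, deleteLetter_of_notMem h, foldl_slide_of_no_bullet]
  rfl

lemma not_movesUp_of_notMem {r c i : ℕ} {α : Type*} [DecidableEq α] {a v : α} {as : List α}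
    {F : Box r c → α} (h : ∀ b, F b ≠ a) : ¬ MovesUp (a :: as) F i v := by
  rintro ⟨as₁, as₂, -, b, b', -, -, -, hS⟩
  rw [deleteLetter_of_notMem h, foldl_slide_of_no_bullet] at hS
  simp at hS

end TwoRows

/-! ### Invariance under renaming of letters -/

section Relabel
variable {r c : ℕ} {α β : Type*} [DecidableEq α] [DecidableEq β] {g : α → β}

lemma deleteLetter_map (hg : Function.Injective g) (a : α) (F : Box r c → α) :
    deleteLetter (g a) (fun b => g (F b)) = fun b => (deleteLetter a F b).map g := by
  funext b
  by_cases h : F b = a <;> simp [deleteLetter, hg.eq_iff, h]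

omit [DecidableEq α] [DecidableEq β] in
lemma map_eq_some_apply_iff (hg : Function.Injective g) {o : Option α} {a : α} :
    o.map g = some (g a) ↔ o = some a := by
  cases o <;> simp [hg.eq_iff]

lemma slide_map (hg : Function.Injective g) (S : Box r c → Option α) (a : α) :
    slide (fun b => (S b).map g) (g a) = fun b => (slide S a b).map g := by
  funext b
  simp only [slide, map_eq_some_apply_iff hg, Option.map_eq_none_iff]
  split_ifs <;> rfl

lemma foldl_slide_map (hg : Function.Injective g) (as : List α) (S : Box r c → Option α) :
    (as.map g).foldl slide (fun b => (S b).map g) = fun b => (as.foldl slide S b).map g := by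
  induction as generalizing S with
  | nil => rfl
  | cons a as ih => simp only [List.map_cons, List.foldl_cons, slide_map hg, ih]

lemma gromotion_map (hg : Function.Injective g) (as : List α) (F : Box r c → α) (b : Box r c) :
    gromotion (as.map g) (fun b => g (F b)) b = g (gromotion as F b) := by
  cases as with
  | nil => rfl
  | cons a as =>
    simp only [List.map_cons, gromotion, deleteLetter_map hg, foldl_slide_map hg]
    cases as.foldl slide (deleteLetter a F) b <;> rfl

lemma movesUp_map_iff (hg : Function.Injective g) (as : List α) (F : Box r c → α) (i : ℕ) (v : α) :
    MovesUp (as.map g) (fun b => g (F b)) i (g v) ↔ MovesUp as F i v := by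
  cases as with
  | nil => rfl
  | cons a as =>
    simp only [List.map_cons, MovesUp]
    constructor
    · rintro ⟨as₁, as₂, h, b, b', h1, h2, h3, hS⟩
      obtain ⟨l₁, l₂, rfl, rfl, h'⟩ := List.map_eq_append_iff.1 h
      obtain ⟨w, l₂, rfl, hw, rfl⟩ := List.map_eq_cons_iff.1 h'
      obtain rfl := hg hw
      refine ⟨l₁, l₂, rfl, b, b', h1, h2, h3, ?_⟩
      simpa only [deleteLetter_map hg, foldl_slide_map hg, slide_map hg, map_eq_some_apply_iff hg,
        Option.map_eq_none_iff] using hS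
    · rintro ⟨as₁, as₂, rfl, b, b', h1, h2, h3, hS⟩
      refine ⟨as₁.map g, as₂.map g, by simp, b, b', h1, h2, h3, ?_⟩
      simpa only [deleteLetter_map hg, foldl_slide_map hg, slide_map hg, map_eq_some_apply_iff hg,
        Option.map_eq_none_iff] using hS

end Relabel

lemma alphabet_eq_map (n k : ℕ) :
    alphabet (n + 1) k = (List.finRange (n + 1)).map (fun v => v + Fin.ofNat (n + 1) k) := by
  apply List.ext_getElem
  · simp [alphabet]
  · intro i h1 h2
    simp only [alphabet, List.getElem_rotate, List.getElem_map]
    ext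
    simp [Fin.val_add]

/-! ### Noncrossing relations: uniqueness and rotation -/

/-- A noncrossing equivalence relation on `[q]` for which `top` holds for the elements that are not
greatest in their class and `bot` for those that are not least. -/
structure IsNoncrossingRel {q : ℕ} (top bot : Fin q → Prop) (R : Fin q → Fin q → Prop) : Prop where
  equiv : Equivalence R
  noncrossing : ∀ a b c d, a < b → b < c → c < d → R a c → R b d → R a b
  top_iff : ∀ v, top v ↔ ∃ w, v < w ∧ R v w
  bot_iff : ∀ v, bot v ↔ ∃ w, w < v ∧ R w v

/-- `u < w` are consecutive elements of a class of `R`. -/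
def Arc {q : ℕ} (R : Fin q → Fin q → Prop) (u w : Fin q) : Prop :=
  u < w ∧ R u w ∧ ∀ z, u < z → z < w → ¬ R u z

namespace IsNoncrossingRel
variable {q : ℕ} {top bot : Fin q → Prop} {R R' : Fin q → Fin q → Prop}

lemma exists_arc_right (h : IsNoncrossingRel top bot R) {u : Fin q} (hu : top u) :
    ∃ w, Arc R u w := by
  obtain ⟨w, ⟨hw, hR⟩, hmin⟩ := wellFounded_lt.has_min {w | u < w ∧ R u w} ((h.top_iff u).1 hu)
  exact ⟨w, hw, hR, fun z hz hzw hRz => hmin z ⟨hz, hRz⟩ hzw⟩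

lemma exists_arc_left (h : IsNoncrossingRel top bot R) {w : Fin q} (hw : bot w) :
    ∃ u, Arc R u w := by
  obtain ⟨u, ⟨hu, hR⟩, hmax⟩ := wellFounded_gt.has_min {u | u < w ∧ R u w} ((h.bot_iff w).1 hw)
  exact ⟨u, hu, hR, fun z hz hzw hRz => hmax z ⟨hzw, h.equiv.trans (h.equiv.symm hRz) hR⟩ hz⟩

/-- Induction on the length of the arc `v, w`. If `w < w'`, let `u, w` be the arc of `R'` ending at
`w`. For `u < v` it crosses `v, w'`, and `u = v` contradicts that `v, w'` is an arc. For `v < u`,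
the arc of `R` from `u` is trapped strictly below `w`, which the induction hypothesis forbids. -/
lemma arc_eq_of_le (h : IsNoncrossingRel top bot R) (h' : IsNoncrossingRel top bot R') (n : ℕ) :
    ∀ v w w', Arc R v w → Arc R' v w' → w.val - v.val ≤ n → w ≤ w' → w = w' := by
  induction n with
  | zero =>
    intro v w w' ha _ hn _
    have := ha.1
    omega
  | succ n ih =>
    intro v w w' ha ha' hn hle
    by_contra hne
    have hlt : w < w' := lt_of_le_of_ne hle hne
    obtain ⟨u, hu⟩ := h'.exists_arc_left ((h.bot_iff w).2 ⟨v, ha.1, ha.2.1⟩)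
    rcases lt_trichotomy u v with huv | rfl | huv
    · have := h'.noncrossing u v w w' huv ha.1 hlt hu.2.1 ha'.2.1
      exact hu.2.2 v huv ha.1 this
    · exact ha'.2.2 w ha.1 hlt hu.2.1
    · obtain ⟨x, hx⟩ := h.exists_arc_right ((h'.top_iff u).2 ⟨w, hu.1, hu.2.1⟩)
      have hxw : x < w := by
        by_contra! hge
        rcases hge.eq_or_lt with rfl | hwx
        · exact ha.2.2 u huv hu.1 (h.equiv.trans ha.2.1 (h.equiv.symm hx.2.1))
        · exact ha.2.2 u huv hu.1 (h.noncrossing v u w x huv hu.1 hwx ha.2.1 hx.2.1)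
      have := ih u x w hx hu (by have := hu.1; omega) hxw.le
      omega

lemma arc_imp (h : IsNoncrossingRel top bot R) (h' : IsNoncrossingRel top bot R') {v w : Fin q}
    (ha : Arc R v w) : Arc R' v w := by
  obtain ⟨w', ha'⟩ := h'.exists_arc_right ((h.top_iff v).2 ⟨w, ha.1, ha.2.1⟩)
  rcases le_total w w' with hle | hle
  · rwa [arc_eq_of_le h h' _ v w w' ha ha' le_rfl hle]
  · rwa [← arc_eq_of_le h' h _ v w' w ha' ha le_rfl hle]

/-- A class is the chain of its arcs, and these are common to both relations. -/
lemma rel_imp_of_lt (h : IsNoncrossingRel top bot R) (h' : IsNoncrossingRel top bot R') (n : ℕ) :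
    ∀ u v, u < v → v.val - u.val ≤ n → R u v → R' u v := by
  induction n with
  | zero => intro u v huv hn _; omega
  | succ n ih =>
    intro u v huv hn hR
    obtain ⟨w, hw⟩ := h.exists_arc_right ((h.top_iff u).2 ⟨v, huv, hR⟩)
    have hw' := arc_imp h h' hw
    rcases lt_trichotomy w v with hwv | rfl | hwv
    · exact h'.equiv.trans hw'.2.1
        (ih w v hwv (by have := hw.1; omega) (h.equiv.trans (h.equiv.symm hw.2.1) hR))
    · exact hw'.2.1
    · exact absurd hR (hw.2.2 v huv hwv)

lemma rel_imp (h : IsNoncrossingRel top bot R) (h' : IsNoncrossingRel top bot R') {u v : Fin q}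
    (hR : R u v) : R' u v := by
  rcases lt_trichotomy u v with huv | rfl | huv
  · exact rel_imp_of_lt h h' _ u v huv le_rfl hR
  · exact h'.equiv.refl _
  · exact h'.equiv.symm (rel_imp_of_lt h h' _ v u huv le_rfl (h.equiv.symm hR))

lemma rel_iff (h : IsNoncrossingRel top bot R) (h' : IsNoncrossingRel top bot R') {u v : Fin q} :
    R u v ↔ R' u v :=
  ⟨rel_imp h h', rel_imp h' h⟩

/-- Moving the least letter `0` to the end of the alphabet preserves noncrossing relations. -/
lemma shift {n : ℕ} {top bot top' bot' : Fin (n + 1) → Prop} {R : Fin (n + 1) → Fin (n + 1) → Prop}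
    (h : IsNoncrossingRel top bot R)
    (htop : ∀ i : Fin n, top' i.castSucc ↔ top i.succ ∨ R 0 i.succ)
    (htop_last : ¬ top' (Fin.last n))
    (hbot : ∀ i : Fin n, bot' i.castSucc ↔ ∃ k : Fin n, k < i ∧ R k.succ i.succ)
    (hbot_last : bot' (Fin.last n) ↔ top 0) :
    IsNoncrossingRel top' bot' (fun u v => R (u + 1) (v + 1)) where
  equiv := ⟨fun _ => h.equiv.refl _, fun h1 => h.equiv.symm h1,
    fun h1 h2 => h.equiv.trans h1 h2⟩
  noncrossing a b c d hab hbc hcd hac hbd := by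
    induction c using Fin.lastCases with
    | last => exact absurd hcd (Fin.le_last d).not_gt
    | cast c =>
    induction b using Fin.lastCases with
    | last => exact absurd hbc (Fin.le_last _).not_gt
    | cast b =>
    induction a using Fin.lastCases with
    | last => exact absurd hab (Fin.le_last _).not_gt
    | cast a =>
    simp only [Fin.coeSucc_eq_succ, Fin.castSucc_lt_castSucc_iff] at *
    induction d using Fin.lastCases with
    | last =>
      -- The last letter stands for the old `0`, so the crossing to exclude is `0 < a + 1 < b + 1 <
      -- c + 1`.
      rw [Fin.last_add_one] at hbd
      have h1 := h.noncrossing 0 a.succ b.succ c.succ (Fin.succ_pos a)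
        (Fin.succ_lt_succ_iff.2 hab) (Fin.succ_lt_succ_iff.2 hbc) (h.equiv.symm hbd) hac
      exact h.equiv.trans (h.equiv.symm h1) (h.equiv.symm hbd)
    | cast d =>
      simp only [Fin.coeSucc_eq_succ, Fin.castSucc_lt_castSucc_iff] at *
      exact h.noncrossing _ _ _ _ (Fin.succ_lt_succ_iff.2 hab) (Fin.succ_lt_succ_iff.2 hbc)
        (Fin.succ_lt_succ_iff.2 hcd) hac hbd
  top_iff v := by
    induction v using Fin.lastCases with
    | last => simp [htop_last, Fin.le_last]
    | cast i =>
      rw [htop, h.top_iff, Fin.exists_fin_succ (P := fun w => i.succ < w ∧ R i.succ w),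
        Fin.exists_fin_succ']
      simp only [Fin.coeSucc_eq_succ, Fin.castSucc_lt_castSucc_iff, Fin.last_add_one,
        Fin.castSucc_lt_last, Fin.succ_lt_succ_iff, true_and, Fin.not_lt_zero,
        false_and, false_or]
      exact or_congr Iff.rfl ⟨h.equiv.symm, h.equiv.symm⟩
  bot_iff v := by
    induction v using Fin.lastCases with
    | last =>
      rw [hbot_last, h.top_iff, Fin.exists_fin_succ (P := fun w => 0 < w ∧ R 0 w),
        Fin.exists_fin_succ']
      simp only [Fin.coeSucc_eq_succ, Fin.last_add_one, Fin.castSucc_lt_last, Fin.succ_pos,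
        true_and, lt_irrefl, false_and, false_or, or_false]
      exact exists_congr fun _ => ⟨h.equiv.symm, h.equiv.symm⟩
    | cast i =>
      rw [hbot, Fin.exists_fin_succ']
      simp [Fin.coeSucc_eq_succ, (Fin.castSucc_lt_last i).le]

end IsNoncrossingRel

/-! ### Motzkin paths and their noncrossing relations -/

/-- `h` is the height function of the Motzkin path of length `q` that has an up step at the `v` with
`top v` only, a down step at the `v` with `bot v` only, and no horizontal step in `bot` at
height `0`. -/
structure IsHeight (q : ℕ) (top bot : ℕ → Prop) (h : ℕ → ℤ) : Prop where
  zero : h 0 = 0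
  final : h q = 0
  both : ∀ t, top t → bot t → h (t + 1) = h t
  up : ∀ t, top t → ¬ bot t → h (t + 1) = h t + 1
  down : ∀ t, ¬ top t → bot t → h (t + 1) = h t - 1
  flat : ∀ t, ¬ top t → ¬ bot t → h (t + 1) = h t
  pos : ∀ t, bot t → 1 ≤ h t

/-- The path returns at `w` to the block that is on top of the stack after `u`, and this block has
not been closed in between. -/
structure Link (top bot : ℕ → Prop) (h : ℕ → ℤ) (u w : ℕ) : Prop where
  lt : u < w
  top_left : top u
  bot_right : bot w
  height : h w = h (u + 1)
  le : ∀ x, u < x → x ≤ w → h (u + 1) ≤ h x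

namespace IsHeight
variable {q : ℕ} {top bot : ℕ → Prop} {h : ℕ → ℤ}

lemma nonneg (H : IsHeight q top bot h) (t : ℕ) : 0 ≤ h t := by
  induction t with
  | zero => exact H.zero.ge
  | succ t ih =>
    by_cases h1 : top t <;> by_cases h2 : bot t
    · have := H.both t h1 h2; omega
    · have := H.up t h1 h2; omega
    · have := H.down t h1 h2; have := H.pos t h2; omega
    · have := H.flat t h1 h2; omega

lemma pos_of_top (H : IsHeight q top bot h) {t : ℕ} (ht : top t) : 1 ≤ h (t + 1) := by
  by_cases h2 : bot t
  · rw [H.both t ht h2]; exact H.pos t h2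
  · rw [H.up t ht h2]; have := H.nonneg t; omega

lemma le_succ_of_not_bot (H : IsHeight q top bot h) {t : ℕ} (ht : ¬ bot t) : h t ≤ h (t + 1) := by
  by_cases h1 : top t
  · have := H.up t h1 ht; omega
  · have := H.flat t h1 ht; omega

lemma succ_le_of_not_top (H : IsHeight q top bot h) {t : ℕ} (ht : ¬ top t) : h (t + 1) ≤ h t := by
  by_cases h1 : bot t
  · have := H.down t ht h1; omega
  · have := H.flat t ht h1; omega

lemma sub_one_le_succ (H : IsHeight q top bot h) (t : ℕ) : h t - 1 ≤ h (t + 1) := by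
  by_cases h1 : bot t
  · by_cases h2 : top t
    · have := H.both t h2 h1; omega
    · have := H.down t h2 h1; omega
  · have := H.le_succ_of_not_bot h1; omega

lemma succ_le_add_one (H : IsHeight q top bot h) (t : ℕ) : h (t + 1) ≤ h t + 1 := by
  by_cases h1 : top t
  · by_cases h2 : bot t
    · have := H.both t h1 h2; omega
    · have := H.up t h1 h2; omega
  · have := H.succ_le_of_not_top h1; omega

lemma link_trans (H : IsHeight q top bot h) {u v w : ℕ} (h1 : Link top bot h u v)
    (h2 : Link top bot h v w) : Link top bot h u w where
  lt := h1.lt.trans h2.lt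
  top_left := h1.top_left
  bot_right := h2.bot_right
  height := by rw [h2.height, H.both v h2.top_left h1.bot_right, h1.height]
  le x hx hxw := by
    rcases le_or_gt x v with hxv | hxv
    · exact h1.le x hx hxv
    · have := h2.le x hxv hxw
      rwa [H.both v h2.top_left h1.bot_right, h1.height] at this

/-- If `v` were not a top letter, the path would go down at `v`, below the level it must keep until
`w`. -/
lemma link_of_left (H : IsHeight q top bot h) {u v w : ℕ} (h1 : Link top bot h u v)
    (h2 : Link top bot h u w) (hvw : v < w) : Link top bot h v w := by
  have h3 := h2.le (v + 1) (h1.lt.trans (Nat.lt_add_one v)) hvw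
  have htop : top v := by
    by_contra h4
    have h5 := H.down v h4 h1.bot_right
    have := h1.height
    omega
  have h4 : h (v + 1) = h (u + 1) := by rw [H.both v htop h1.bot_right, h1.height]
  exact ⟨hvw, htop, h2.bot_right, by rw [h4, h2.height],
    fun x hx hxw => h4 ▸ h2.le x (h1.lt.trans hx) hxw⟩

lemma link_of_right (H : IsHeight q top bot h) {u v w : ℕ} (h1 : Link top bot h u w)
    (h2 : Link top bot h v w) (huv : u < v) : Link top bot h u v := by
  have h3 := h1.le v huv h2.lt.le
  have h4 := h1.height
  have h5 := h2.height
  have hbot : bot v := by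
    by_contra h6
    have := H.up v h2.top_left h6
    omega
  have h6 := H.both v h2.top_left hbot
  exact ⟨huv, h1.top_left, hbot, by omega, fun x hx hxv => h1.le x hx (hxv.trans h2.lt.le)⟩

/-- An up step at `b` would keep the path above `h (a + 1)` until `d`, yet it is at that level at
`c`. So `b` is flat, at exactly this level. -/
lemma link_of_crossing (H : IsHeight q top bot h) {a b c d : ℕ} (hab : a < b) (hbc : b < c)
    (hcd : c < d) (h1 : Link top bot h a c) (h2 : Link top bot h b d) : Link top bot h a b := by
  have h3 := h1.le b hab hbc.le
  have h4 := h2.le c hbc hcd.le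
  have h5 := h1.le (b + 1) (by omega) hbc
  have h6 := h1.height
  have hbot : bot b := by
    by_contra h7
    have := H.up b h2.top_left h7
    omega
  have h7 := H.both b h2.top_left hbot
  exact ⟨hab, h1.top_left, hbot, by omega, fun x hx hxb => h1.le x hx (hxb.trans hbc.le)⟩

lemma exists_link_right (H : IsHeight q top bot h) {u : ℕ} (hu : top u) (huq : u < q) :
    ∃ w < q, Link top bot h u w := by
  classical
  have hpos := H.pos_of_top hu
  have hex : ∃ w, u < w ∧ h (w + 1) < h (u + 1) := by
    refine ⟨q - 1, ?_, ?_⟩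
    · by_contra! hle
      have hq : u + 1 = q := by omega
      rw [hq, H.final] at hpos
      omega
    · rw [show q - 1 + 1 = q by omega, H.final]; omega
  -- the path is above the height after `u` until the first bottom letter that reaches it
  let P : ℕ → Prop := fun w => u < w ∧ bot w ∧ h w ≤ h (u + 1)
  -- The path ends at height `0`, so it leaves the level `h (u + 1)` downwards before `q`; the
  -- letter where it first does so is a witness.
  have hP : ∃ w < q, P w := by
    have hmin := fun m hm => Nat.find_min (m := m) hex hm
    obtain ⟨h1, h2⟩ := Nat.find_spec hex
    set w := Nat.find hex
    have hge : h (u + 1) ≤ h w := by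
      rcases (show u + 1 ≤ w from h1).eq_or_lt with h3 | h3
      · rw [h3]
      · by_contra! h4
        refine hmin (w - 1) (by omega) ⟨by omega, ?_⟩
        rwa [show w - 1 + 1 = w by omega]
    have hbot : bot w := by
      by_contra h3
      have := H.le_succ_of_not_bot h3
      omega
    have hwq : w ≤ q - 1 := by
      refine Nat.find_min' hex ⟨?_, ?_⟩
      · by_contra! hle
        have hq : u + 1 = q := by omega
        rw [hq, H.final] at hpos
        omega
      · rw [show q - 1 + 1 = q by omega, H.final]; omega
    have := H.sub_one_le_succ w
    exact ⟨w, by omega, h1, hbot, by omega⟩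
  have hP' : ∃ w, P w := let ⟨w, _, hw⟩ := hP; ⟨w, hw⟩
  obtain ⟨w₀, hw₀q, hw₀⟩ := hP
  have hle := Nat.find_min' hP' hw₀
  have hmin := fun m hm => Nat.find_min (m := m) hP' hm
  obtain ⟨h1, h2, h3⟩ := Nat.find_spec hP'
  set w := Nat.find hP'
  have key : ∀ x, u < x → x ≤ w → h (u + 1) ≤ h x := by
    intro x hx
    induction x, hx using Nat.le_induction with
    | base => intro _; exact le_rfl
    | succ x hx ih =>
      intro hxw
      have h4 := ih (by omega)
      by_cases hb : bot x
      · have h5 : h (u + 1) < h x := by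
          by_contra! h6
          exact hmin x (by omega) ⟨hx, hb, h6⟩
        have := H.sub_one_le_succ x
        omega
      · exact h4.trans (H.le_succ_of_not_bot hb)
  exact ⟨w, by omega, h1, hu, h2, le_antisymm h3 (key w h1 le_rfl), key⟩

/-- Going left from `w`, the height stays at least `h w` until a top letter is met after which it
equals `h w`. One must be met, since `h 0 = 0 < h w`. -/
lemma exists_link_left (H : IsHeight q top bot h) {w : ℕ} (hw : bot w) :
    ∃ u, Link top bot h u w := by
  classical
  -- search leftwards from `w`
  have hpos := H.pos w hw
  have main : ∀ n, n ≤ w → (∀ x, n ≤ x → x ≤ w → h w ≤ h x) → ∃ u, Link top bot h u w := by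
    intro n
    induction n with
    | zero =>
      intro _ hx
      have := hx 0 le_rfl (Nat.zero_le w)
      rw [H.zero] at this
      omega
    | succ n ih =>
      intro hn hx
      have h1 := hx (n + 1) le_rfl hn
      by_cases hu : top n ∧ h (n + 1) = h w
      · exact ⟨n, hn, hu.1, hw, hu.2.symm, fun x h3 h4 => hu.2 ▸ hx x h3 h4⟩
      · refine ih (by omega) fun x h3 h4 => ?_
        rcases h3.eq_or_lt with rfl | h3
        · by_cases ht : top n
          · have : h (n + 1) ≠ h w := fun h5 => hu ⟨ht, h5⟩
            have := H.succ_le_add_one n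
            omega
          · exact h1.trans (H.succ_le_of_not_top ht)
        · exact hx x h3 h4
  exact main w le_rfl fun x h1 h2 => by rw [le_antisymm h2 h1]

/-- The noncrossing relation of a Motzkin path. -/
lemma isNoncrossingRel (H : IsHeight q top bot h) :
    IsNoncrossingRel (fun v : Fin q => top v) (fun v : Fin q => bot v)
      (fun u v => u = v ∨ Link top bot h u v ∨ Link top bot h v u) where
  equiv := by
    refine ⟨fun _ => Or.inl rfl, ?_, ?_⟩
    · rintro u v (rfl | h1 | h1)
      exacts [Or.inl rfl, Or.inr (Or.inr h1), Or.inr (Or.inl h1)]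
    · rintro u v w (rfl | h1 | h1) (rfl | h2 | h2)
      · exact Or.inl rfl
      · exact Or.inr (Or.inl h2)
      · exact Or.inr (Or.inr h2)
      · exact Or.inr (Or.inl h1)
      · exact Or.inr (Or.inl (H.link_trans h1 h2))
      · rcases lt_trichotomy u w with h3 | h3 | h3
        · exact Or.inr (Or.inl (H.link_of_right h1 h2 h3))
        · exact Or.inl h3
        · exact Or.inr (Or.inr (H.link_of_right h2 h1 h3))
      · exact Or.inr (Or.inr h1)
      · rcases lt_trichotomy u w with h3 | h3 | h3
        · exact Or.inr (Or.inl (H.link_of_left h1 h2 h3))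
        · exact Or.inl h3
        · exact Or.inr (Or.inr (H.link_of_left h2 h1 h3))
      · exact Or.inr (Or.inr (H.link_trans h2 h1))
  noncrossing := by
    rintro a b c d hab hbc hcd (rfl | h1 | h1) (rfl | h2 | h2)
    · omega
    · omega
    · omega
    · omega
    · exact Or.inr (Or.inl (H.link_of_crossing hab hbc hcd h1 h2))
    · have := h2.lt; omega
    · omega
    · have := h1.lt; omega
    · have := h1.lt; omega
  top_iff v := by
    constructor
    · intro hv
      obtain ⟨w, hwq, hw⟩ := H.exists_link_right hv v.2
      exact ⟨⟨w, hwq⟩, hw.lt, Or.inr (Or.inl hw)⟩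
    · rintro ⟨w, hvw, rfl | h1 | h1⟩
      · exact absurd hvw (lt_irrefl _)
      · exact h1.top_left
      · have := h1.lt; omega
  bot_iff v := by
    constructor
    · intro hv
      obtain ⟨u, hu⟩ := H.exists_link_left hv
      exact ⟨⟨u, hu.lt.trans v.2⟩, hu.lt, Or.inr (Or.inl hu)⟩
    · rintro ⟨w, hvw, rfl | h1 | h1⟩
      · exact absurd hvw (lt_irrefl _)
      · exact h1.bot_right
      · have := h1.lt; omega

end IsHeight

/-! ### Counting the terms of a sequence below a bound -/

section Count
open Classical in
/-- The number of terms of the sequence `x` below `t`. -/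
noncomputable def countBelow (x : ℕ → ℕ) (t : ℕ) : ℕ := Nat.count (fun v => ∃ j, x j = v) t

lemma lt_countBelow_iff {x : ℕ → ℕ} (hx : StrictMono x) {j t : ℕ} : j < countBelow x t ↔ x j < t := by
  classical
  have key : countBelow x (x j) = j := by
    rw [countBelow, Nat.count_eq_card_filter_range]
    have : {v ∈ Finset.range (x j) | ∃ i, x i = v} = (Finset.range j).image x := by
      ext v
      simp only [Finset.mem_filter, Finset.mem_range, Finset.mem_image]
      constructor
      · rintro ⟨h1, i, rfl⟩
        exact ⟨i, hx.lt_iff_lt.1 h1, rfl⟩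
      · rintro ⟨i, h1, rfl⟩
        exact ⟨hx h1, i, rfl⟩
    convert congrArg Finset.card this
    rw [Finset.card_image_of_injective _ hx.injective, Finset.card_range]
  constructor
  · intro h
    by_contra! hle
    have : countBelow x t ≤ countBelow x (x j) := Nat.count_monotone _ hle
    omega
  · intro h
    have : countBelow x (x j) < countBelow x t := Nat.count_strict_mono ⟨j, rfl⟩ h
    omega

lemma countBelow_eq {x : ℕ → ℕ} (hx : StrictMono x) (j : ℕ) : countBelow x (x j) = j := by
  have h1 := (lt_countBelow_iff hx (j := j) (t := x j)).not.2 (lt_irrefl _)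
  rcases Nat.eq_zero_or_pos j with rfl | hj
  · omega
  · have := (lt_countBelow_iff hx (j := j - 1)).2 (hx (show j - 1 < j by omega))
    omega

lemma countBelow_succ_of_mem {x : ℕ → ℕ} {t : ℕ} (h : ∃ j, x j = t) :
    countBelow x (t + 1) = countBelow x t + 1 := by
  rw [countBelow, Nat.count_succ, if_pos h, countBelow]

lemma countBelow_succ_of_notMem {x : ℕ → ℕ} {t : ℕ} (h : ¬ ∃ j, x j = t) :
    countBelow x (t + 1) = countBelow x t := by
  rw [countBelow, Nat.count_succ, if_neg h, countBelow, Nat.add_zero]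

end Count

/-! ### The Motzkin path of a tableau -/

section Rows
variable {c q r s : ℕ} {x y : ℕ → ℕ}

/-- The height function of the Motzkin path of a tableau with rows `x` and `y`. -/
noncomputable def rowHeight (x y : ℕ → ℕ) (t : ℕ) : ℤ := (countBelow x t : ℤ) - countBelow y t

/-- Each row has exactly `c` entries below `q`, so the path ends at `0`. Column strictness is the
ballot condition: at `y j` the top row has already contributed at least `j + 1` letters, the bottom
row only `j`. -/
lemma IsRows.isHeight (h : IsRows c q x y) :
    IsHeight q (fun v => ∃ j, x j = v) (fun v => ∃ j, y j = v) (rowHeight x y) where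
  zero := by simp [rowHeight, countBelow]
  final := by
    have hx := fun j => lt_countBelow_iff h.xmono (j := j) (t := q)
    have hy := fun j => lt_countBelow_iff h.ymono (j := j) (t := q)
    have key : ∀ j, j < countBelow x q ↔ j < countBelow y q := by
      intro j
      rw [hx, hy]
      have h1 := h.lt j
      rcases lt_or_ge j c with hj | hj
      · have := h.y_lt j hj; omega
      · have := h.x_ge j hj; omega
    have h1 := key (countBelow x q)
    have h2 := key (countBelow y q)
    unfold rowHeight
    omega
  both t h1 h2 := by
    simp only [rowHeight, countBelow_succ_of_mem h1, countBelow_succ_of_mem h2]; omega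
  up t h1 h2 := by
    simp only [rowHeight, countBelow_succ_of_mem h1, countBelow_succ_of_notMem h2]; omega
  down t h1 h2 := by
    simp only [rowHeight, countBelow_succ_of_notMem h1, countBelow_succ_of_mem h2]; omega
  flat t h1 h2 := by
    simp only [rowHeight, countBelow_succ_of_notMem h1, countBelow_succ_of_notMem h2]
  pos := by
    rintro t ⟨j, rfl⟩
    have := (lt_countBelow_iff h.xmono).2 (h.lt j)
    rw [rowHeight, countBelow_eq h.ymono]
    omega

/-- Height one at `y j` means `x j < y j ≤ x (j + 1)`. Height at least one until then means `x (i +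
1) ≤ y i` for `i < j`, that is, `j ≤ s`. Together they say that column `j` of the new top row holds
`y j`, by a tie if `j < s`. -/
lemma link_zero_iff (h : IsRows c q x y) (ht : IsTurn x y r s) (h0 : x 0 = 0) {v : ℕ} :
    Link (fun v => ∃ j, x j = v) (fun v => ∃ j, y j = v) (rowHeight x y) 0 v ↔
      ∃ j, newTop x y s j = v ∧ y j = v := by
  have hx := fun j t => lt_countBelow_iff h.xmono (j := j) (t := t)
  have hy := fun j t => lt_countBelow_iff h.ymono (j := j) (t := t)
  have h1 : rowHeight x y (0 + 1) = 1 := by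
    have e1 := (hx 0 1).2 (by omega)
    have e2 := (hx 1 1).not.2 (by have := h.xmono Nat.zero_lt_one; omega)
    have e3 := (hy 0 1).not.2 (by have := h.lt 0; omega)
    unfold rowHeight
    rw [Nat.zero_add]
    omega
  constructor
  · rintro ⟨hlt, -, ⟨j, rfl⟩, hh, hle⟩
    rw [h1] at hh hle
    have e1 := countBelow_eq h.ymono j
    unfold rowHeight at hh hle
    have e2 := (hx (j + 1) (y j)).not.1 (by omega)
    -- Otherwise the path would be back at height zero just after `y i`.
    have before : ∀ i < j, x (i + 1) ≤ y i := by
      intro i hi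
      have e3 := hle (y i + 1) (by omega) (h.ymono hi)
      have e4 := (hy i (y i + 1)).2 (by omega)
      have := (hx (i + 1) (y i + 1)).1 (by omega)
      omega
    have hjs : j ≤ s := by
      by_contra! hlt
      have := before s hlt
      have := ht.at_s
      omega
    refine ⟨j, ?_, rfl⟩
    unfold newTop
    split_ifs with h3
    · have := ht.before_s j h3; omega
    · rfl
    · omega
  · rintro ⟨j, hv, rfl⟩
    have hxy := h.lt j
    have hjs : j ≤ s ∧ y j ≤ x (j + 1) := by
      unfold newTop at hv
      split_ifs at hv with h3 h4
      · exact ⟨h3.le, hv.ge⟩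
      · have := ht.at_s; rw [← h4] at this; exact ⟨h4.le, this.le⟩
      · omega
    have e1 := countBelow_eq h.ymono j
    refine ⟨by omega, ⟨0, h0⟩, ⟨j, rfl⟩, ?_, fun z hz hzv => ?_⟩
    · have e2 := (hx j (y j)).2 hxy
      have e3 := (hx (j + 1) (y j)).not.2 (by omega)
      rw [h1]
      unfold rowHeight
      omega
    · rw [h1]
      have e2 := (hy j z).not.2 (by omega)
      -- One more top letter than bottom letters lies below `z`: the last bottom letter `y i` below
      -- `z` satisfies `x (i + 1) ≤ y i`.
      have e3 : x (countBelow y z) < z := by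
        rcases Nat.eq_zero_or_pos (countBelow y z) with h4 | h4
        · rw [h4]; omega
        · have e4 := (hy (countBelow y z - 1) z).1 (by omega)
          have e5 := ht.before_s (countBelow y z - 1) (by omega)
          rw [Nat.sub_add_cancel h4] at e5
          omega
      have := (hx _ _).2 e3
      unfold rowHeight
      omega

end Rows

/-! ### Set partitions as equivalence relations -/

section Partition
variable {q : ℕ} (π : Finpartition (Finset.univ : Finset (Fin q)))

/-- `u` and `v` lie in the same block of `π`. -/
def SameBlock (u v : Fin q) : Prop := ∃ B ∈ π.parts, u ∈ B ∧ v ∈ B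

variable {π}

lemma sameBlock_iff {B : Finset (Fin q)} (hB : B ∈ π.parts) {u v : Fin q} (hu : u ∈ B) :
    SameBlock π u v ↔ v ∈ B := by
  constructor
  · rintro ⟨B', hB', hu', hv'⟩
    rwa [π.eq_of_mem_parts hB hB' hu hu']
  · exact fun hv => ⟨B, hB, hu, hv⟩

lemma sameBlock_equivalence : Equivalence (SameBlock π) := by
  refine ⟨fun u => ?_, ?_, ?_⟩
  · obtain ⟨B, hB, hu⟩ := π.exists_mem (Finset.mem_univ u)
    exact ⟨B, hB, hu, hu⟩
  · rintro u v ⟨B, hB, hu, hv⟩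
    exact ⟨B, hB, hv, hu⟩
  · rintro u v w ⟨B, hB, hu, hv⟩ h
    exact ⟨B, hB, hu, (sameBlock_iff hB hv).1 h⟩

lemma isLeast_iff {B : Finset (Fin q)} (hB : B ∈ π.parts) {v : Fin q} (hv : v ∈ B) :
    IsLeast (B : Set (Fin q)) v ↔ ¬ ∃ w, w < v ∧ SameBlock π w v := by
  constructor
  · rintro ⟨-, h⟩ ⟨w, hw, hs⟩
    exact absurd (h ((sameBlock_iff hB hv).1 (sameBlock_equivalence.symm hs))) hw.not_ge
  · intro h
    exact ⟨hv, fun w hw => not_lt.1 fun hlt => h ⟨w, hlt, B, hB, hw, hv⟩⟩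

lemma isGreatest_iff {B : Finset (Fin q)} (hB : B ∈ π.parts) {v : Fin q} (hv : v ∈ B) :
    IsGreatest (B : Set (Fin q)) v ↔ ¬ ∃ w, v < w ∧ SameBlock π v w := by
  constructor
  · rintro ⟨-, h⟩ ⟨w, hw, hs⟩
    exact absurd (h ((sameBlock_iff hB hv).1 hs)) hw.not_ge
  · intro h
    exact ⟨hv, fun w hw => not_lt.1 fun hlt => h ⟨w, hlt, B, hB, hv, hw⟩⟩

lemma one_lt_card_iff {B : Finset (Fin q)} (hB : B ∈ π.parts) {v : Fin q} (hv : v ∈ B) :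
    1 < B.card ↔ (∃ w, v < w ∧ SameBlock π v w) ∨ ∃ w, w < v ∧ SameBlock π w v := by
  constructor
  · intro h
    obtain ⟨w, hw, hne⟩ := Finset.exists_mem_ne h v
    rcases lt_or_gt_of_ne hne with hlt | hlt
    · exact Or.inr ⟨w, hlt, B, hB, hw, hv⟩
    · exact Or.inl ⟨w, hlt, B, hB, hv, hw⟩
  · rintro (⟨w, hw, hs⟩ | ⟨w, hw, hs⟩)
    · exact Finset.one_lt_card.2 ⟨v, hv, w, (sameBlock_iff hB hv).1 hs, hw.ne⟩
    · exact Finset.one_lt_card.2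
        ⟨v, hv, w, (sameBlock_iff hB hv).1 (sameBlock_equivalence.symm hs), hw.ne'⟩

lemma singleton_mem_parts_iff {B : Finset (Fin q)} (hB : B ∈ π.parts) {v : Fin q} (hv : v ∈ B) :
    {v} ∈ π.parts ↔ ¬ 1 < B.card := by
  constructor
  · intro h
    rw [π.eq_of_mem_parts hB h hv (Finset.mem_singleton_self v)]
    simp
  · intro h
    obtain ⟨w, rfl⟩ := Finset.card_eq_one.1
      (le_antisymm (not_lt.1 h) (Finset.card_pos.2 ⟨v, hv⟩))
    rwa [Finset.mem_singleton.1 hv]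

lemma isNoncrossing_iff : IsNoncrossing π ↔ ∀ a b c d, a < b → b < c → c < d →
    SameBlock π a c → SameBlock π b d → SameBlock π a b := by
  constructor
  · rintro h a b c d hab hbc hcd ⟨B, hB, ha, hc⟩ ⟨B', hB', hb, hd⟩
    obtain rfl := h B hB B' hB' a b c d hab hbc hcd ha hc hb hd
    exact ⟨B, hB, ha, hb⟩
  · intro h B hB B' hB' a b c d hab hbc hcd ha hc hb hd
    have := h a b c d hab hbc hcd ⟨B, hB, ha, hc⟩ ⟨B', hB', hb, hd⟩
    exact π.eq_of_mem_parts hB hB' ((sameBlock_iff hB ha).1 this) hb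

/-- Two truth values have four combinations; matching three of them matches the fourth. -/
lemma iff_and_iff_of_cases {P Q A B : Prop} (h1 : ¬P ∧ ¬Q ↔ ¬A ∧ ¬B) (h2 : P ∧ ¬Q ↔ A ∧ ¬B)
    (h3 : ¬P ∧ Q ↔ ¬A ∧ B) : (A ↔ P) ∧ (B ↔ Q) := by
  by_cases P <;> by_cases Q <;> by_cases A <;> by_cases B <;> simp_all

/-- The block conditions sort the letters by whether they are least or greatest in their block. They
amount to two rules: a letter is in the top row iff it is not greatest, and in the bottom row iff it
is not least. -/
lemma isPartitionOf_iff {c : ℕ} {T : IncTableau 2 c q} : IsPartitionOf T π ↔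
    IsNoncrossingRel (AppearsInRow T 0) (AppearsInRow T 1) (SameBlock π) := by
  have hex : ∀ v, ∃ B ∈ π.parts, v ∈ B := fun v => π.exists_mem (Finset.mem_univ v)
  have hleast : ∀ v, (∃ B ∈ π.parts, 1 < B.card ∧ IsLeast (B : Set (Fin q)) v) ↔
      (∃ w, v < w ∧ SameBlock π v w) ∧ ¬ ∃ w, w < v ∧ SameBlock π w v := by
    intro v
    constructor
    · rintro ⟨B, hB, h1, h2⟩
      have hv : v ∈ B := h2.1
      rw [isLeast_iff hB hv] at h2
      exact ⟨((one_lt_card_iff hB hv).1 h1).resolve_right h2, h2⟩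
    · rintro ⟨h1, h2⟩
      obtain ⟨B, hB, hv⟩ := hex v
      exact ⟨B, hB, (one_lt_card_iff hB hv).2 (Or.inl h1), (isLeast_iff hB hv).2 h2⟩
  have hgreatest : ∀ v, (∃ B ∈ π.parts, 1 < B.card ∧ IsGreatest (B : Set (Fin q)) v) ↔
      (¬ ∃ w, v < w ∧ SameBlock π v w) ∧ ∃ w, w < v ∧ SameBlock π w v := by
    intro v
    constructor
    · rintro ⟨B, hB, h1, h2⟩
      have hv : v ∈ B := h2.1
      rw [isGreatest_iff hB hv] at h2
      exact ⟨h2, ((one_lt_card_iff hB hv).1 h1).resolve_left h2⟩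
    · rintro ⟨h1, h2⟩
      obtain ⟨B, hB, hv⟩ := hex v
      exact ⟨B, hB, (one_lt_card_iff hB hv).2 (Or.inr h2), (isGreatest_iff hB hv).2 h1⟩
  have hsingle : ∀ v, {v} ∈ π.parts ↔
      (¬ ∃ w, v < w ∧ SameBlock π v w) ∧ ¬ ∃ w, w < v ∧ SameBlock π w v := by
    intro v
    obtain ⟨B, hB, hv⟩ := hex v
    rw [singleton_mem_parts_iff hB hv, one_lt_card_iff hB hv, not_or]
  constructor
  · intro h
    have key : ∀ v, (AppearsInRow T 0 v ↔ ∃ w, v < w ∧ SameBlock π v w) ∧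
        (AppearsInRow T 1 v ↔ ∃ w, w < v ∧ SameBlock π w v) := by
      intro v
      exact iff_and_iff_of_cases ((hsingle v).symm.trans (h.singleton_iff v))
        ((hleast v).symm.trans (h.least_iff v)) ((hgreatest v).symm.trans (h.greatest_iff v))
    exact ⟨sameBlock_equivalence, isNoncrossing_iff.1 h.noncrossing, fun v => (key v).1,
      fun v => (key v).2⟩
  · intro h
    refine ⟨isNoncrossing_iff.2 h.noncrossing, fun v => ?_, fun v => ?_, fun v => ?_,
      fun v h0 h1 B hB hv => ?_⟩
    · rw [hsingle, h.top_iff, h.bot_iff]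
    · rw [hleast, h.top_iff, h.bot_iff]
    · rw [hgreatest, h.top_iff, h.bot_iff]
    · rw [isLeast_iff hB hv, isGreatest_iff hB hv, ← h.top_iff, ← h.bot_iff, not_not, not_not]
      exact ⟨h1, h0⟩

lemma eq_of_sameBlock_iff {π' : Finpartition (Finset.univ : Finset (Fin q))}
    (h : ∀ u v, SameBlock π u v ↔ SameBlock π' u v) : π = π' := by
  have key : ∀ {σ τ : Finpartition (Finset.univ : Finset (Fin q))},
      (∀ u v, SameBlock σ u v ↔ SameBlock τ u v) → ∀ B ∈ σ.parts, B ∈ τ.parts := by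
    intro σ τ h B hB
    obtain ⟨u, hu⟩ := σ.nonempty_of_mem_parts hB
    obtain ⟨B', hB', hu'⟩ := τ.exists_mem (Finset.mem_univ u)
    have : B = B' := by
      ext v
      rw [← sameBlock_iff hB hu, h, sameBlock_iff hB' hu']
    rwa [this]
  ext B
  exact ⟨key h B, key (fun u v => (h u v).symm) B⟩

lemma exists_sameBlock_iff {R : Fin q → Fin q → Prop} (hR : Equivalence R) :
    ∃ π : Finpartition (Finset.univ : Finset (Fin q)), ∀ u v, SameBlock π u v ↔ R u v := by
  classical
  let S : Setoid (Fin q) := ⟨R, hR⟩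
  refine ⟨Finpartition.ofSetoid S, fun u v => ?_⟩
  have h := Finpartition.mem_part_ofSetoid_iff_rel (s := S) (a := u) (b := v)
  rw [Finpartition.mem_part_iff_exists] at h
  refine Iff.trans ?_ h
  exact ⟨fun ⟨B, h1, h2, h3⟩ => ⟨B, h1, h3, h2⟩, fun ⟨B, h1, h2, h3⟩ => ⟨B, h1, h3, h2⟩⟩

end Partition

/-! ### From tableaux to rows; the step when the least letter is absent -/

section Tableau
variable {c q : ℕ}

/-- Row `i` of a tableau, continued by letters from `q` on. -/
def extendRow (T : IncTableau 2 c q) (i : Fin 2) (j : ℕ) : ℕ :=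
  if h : j < c then (T.entry (i, ⟨j, h⟩)).val else q + i.val + (j - c)

lemma extendRow_of_lt (T : IncTableau 2 c q) (i : Fin 2) {j : ℕ} (h : j < c) :
    extendRow T i j = (T.entry (i, ⟨j, h⟩)).val := dif_pos h

lemma extendRow_strictMono (T : IncTableau 2 c q) (i : Fin 2) : StrictMono (extendRow T i) := by
  intro j j' hj
  unfold extendRow
  split_ifs with h1 h2 h2
  · exact T.row_strict i _ _ hj
  · have := (T.entry (i, ⟨j, h1⟩)).2
    omega
  · omega
  · omega

lemma isRows_extendRow (T : IncTableau 2 c q) : IsRows c q (extendRow T 0) (extendRow T 1) where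
  xmono := extendRow_strictMono T 0
  ymono := extendRow_strictMono T 1
  lt j := by
    unfold extendRow
    split_ifs with h
    · exact T.col_strict 0 1 ⟨j, h⟩ Fin.zero_lt_one
    · simp
  x_ge j hj := by
    rw [extendRow, dif_neg (by omega)]
    omega
  y_lt j hj := by
    rw [extendRow_of_lt T 1 hj]
    exact (T.entry _).2

lemma appearsInRow_iff {T : IncTableau 2 c q} {i : Fin 2} {v : Fin q} :
    AppearsInRow T i v ↔ ∃ j, extendRow T i j = v.val := by
  constructor
  · rintro ⟨j, rfl⟩
    exact ⟨j, extendRow_of_lt T i j.2⟩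
  · rintro ⟨j, hj⟩
    have hjc : j < c := by
      by_contra h
      rw [extendRow, dif_neg h] at hj
      omega
    rw [extendRow_of_lt T i hjc] at hj
    exact ⟨⟨j, hjc⟩, Fin.ext hj⟩

lemma ofRows_extendRow (T : IncTableau 2 c q) :
    ofRows c (extendRow T 0) (extendRow T 1) = fun b => (T.entry b).val := by
  funext ⟨i, j⟩
  fin_cases i
  · simpa using extendRow_of_lt T 0 j.2
  · simpa using extendRow_of_lt T 1 j.2

/-- The noncrossing relation of a tableau. -/
lemma exists_isNoncrossingRel (T : IncTableau 2 c q) :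
    ∃ R, IsNoncrossingRel (AppearsInRow T 0) (AppearsInRow T 1) R := by
  have h := (isRows_extendRow T).isHeight.isNoncrossingRel
  simp only [← appearsInRow_iff] at h
  exact ⟨_, h⟩

/-- By uniqueness `R` is the relation of the Motzkin path, for which the class of `0` is known. -/
lemma rel_zero_iff {n r s : ℕ} {T : IncTableau 2 c (n + 1)} {R : Fin (n + 1) → Fin (n + 1) → Prop}
    (hR : IsNoncrossingRel (AppearsInRow T 0) (AppearsInRow T 1) R)
    (ht : IsTurn (extendRow T 0) (extendRow T 1) r s) (h0 : extendRow T 0 0 = 0)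
    {v : Fin (n + 1)} (hv : v ≠ 0) : R 0 v ↔
      ∃ j, newTop (extendRow T 0) (extendRow T 1) s j = v.val ∧ extendRow T 1 j = v.val := by
  have h := (isRows_extendRow T).isHeight.isNoncrossingRel (q := n + 1)
  simp only [← appearsInRow_iff] at h
  rw [hR.rel_iff h, ← link_zero_iff (isRows_extendRow T) ht h0]
  constructor
  · rintro (h1 | h1 | h1)
    · exact absurd h1.symm hv
    · exact h1
    · exact absurd h1.lt (Nat.not_lt_zero _)
  · exact fun h1 => Or.inr (Or.inl h1)

/-- The tableau obtained from a filling by decreasing all its entries by one. -/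
def predTableau {r c n : ℕ} (g : Box r c → ℕ) (hpos : ∀ b, 0 < g b) (hle : ∀ b, g b ≤ n + 1)
    (hrow : ∀ (i : Fin r) (j j' : Fin c), j < j' → g (i, j) < g (i, j'))
    (hcol : ∀ (i i' : Fin r) (j : Fin c), i < i' → g (i, j) < g (i', j)) :
    IncTableau r c (n + 1) where
  entry b := ⟨g b - 1, by have := hle b; omega⟩
  row_strict i j j' h := by
    have := hrow i j j' h
    have := hpos (i, j)
    simp only [Fin.mk_lt_mk]
    omega
  col_strict i i' j h := by
    have := hcol i i' j h
    have := hpos (i, j)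
    simp only [Fin.mk_lt_mk]
    omega

lemma appearsInRow_predTableau {c n : ℕ} {g : Box 2 c → ℕ} {hpos hle hrow hcol} {i : Fin 2}
    {v : Fin (n + 1)} : AppearsInRow (predTableau g hpos hle hrow hcol) i v ↔
      ∃ j, g (i, j) = v.val + 1 := by
  refine exists_congr fun j => ?_
  have := hpos (i, j)
  simp only [predTableau, Fin.ext_iff]
  omega

lemma predTableau_entry_add_one {r c n : ℕ} {g : Box r c → ℕ} {hpos hle hrow hcol} (b : Box r c) :
    ((predTableau (n := n) g hpos hle hrow hcol).entry b + 1).val = g b % (n + 1) := by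
  have := hpos b
  simp only [predTableau, Fin.val_add]
  rcases n with _ | n
  · simp [Nat.mod_one]
  · simp only [Fin.val_one]
    congr 1; omega

lemma map_val_finRange (n : ℕ) : (List.finRange n).map Fin.val = List.range n := by
  apply List.ext_getElem <;> simp

lemma finRange_succ_eq_cons (n : ℕ) :
    ∃ as, List.finRange (n + 1) = (0 : Fin (n + 1)) :: as := ⟨_, List.finRange_succ⟩

/-- The effect of one `K`-gromotion, with the alphabet renamed to `0 < ⋯ < n` again, on a tableau in
which the least letter does not appear. -/
lemma gromotion_step_of_notMem {n : ℕ} (T : IncTableau 2 c (n + 1))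
    {R : Fin (n + 1) → Fin (n + 1) → Prop}
    (hR : IsNoncrossingRel (AppearsInRow T 0) (AppearsInRow T 1) R) (hT : ∀ b, T.entry b ≠ 0) :
    ∃ T' : IncTableau 2 c (n + 1),
      (∀ b, gromotion (List.finRange (n + 1)) T.entry b = T'.entry b + 1) ∧
      IsNoncrossingRel (AppearsInRow T' 0) (AppearsInRow T' 1) (fun u v => R (u + 1) (v + 1)) ∧
      ∀ v, MovesUp (List.finRange (n + 1)) T.entry 1 v ↔ v ≠ 0 ∧ R 0 v := by
  have hpos : ∀ b, 0 < (T.entry b).val := fun b => Fin.pos_iff_ne_zero.2 (hT b)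
  have happ : ∀ i, ¬ AppearsInRow T i 0 := fun i ⟨j, hj⟩ => hT _ hj
  have hR0 : ∀ v, v ≠ 0 → ¬ R 0 v := fun v hv h =>
    happ 0 ((hR.top_iff 0).2 ⟨v, Fin.pos_iff_ne_zero.2 hv, h⟩)
  obtain ⟨as, has⟩ := finRange_succ_eq_cons n
  refine ⟨predTableau (fun b => (T.entry b).val) hpos (fun b => (T.entry b).2.le)
    (fun i j j' h => T.row_strict i j j' h) (fun i i' j h => T.col_strict i i' j h), ?_, ?_, ?_⟩
  · intro b
    rw [has, gromotion_of_notMem hT]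
    ext
    rw [predTableau_entry_add_one, Nat.mod_eq_of_lt (T.entry b).2]
  · have hsucc : ∀ (k : Fin 2) (i : Fin n),
        (∃ j, (T.entry (k, j)).val = i.castSucc.val + 1) ↔ AppearsInRow T k i.succ := by
      intro k i
      simp [AppearsInRow, Fin.ext_iff]
    have hlast : ∀ k : Fin 2, ¬ ∃ j, (T.entry (k, j)).val = (Fin.last n).val + 1 := by
      rintro k ⟨j, hj⟩
      have := (T.entry (k, j)).2
      rw [Fin.val_last] at hj
      omega
    apply hR.shift
    · intro i
      rw [appearsInRow_predTableau, hsucc]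
      simp [hR0 i.succ (Fin.succ_ne_zero i)]
    · rw [appearsInRow_predTableau]
      exact hlast 0
    · intro i
      rw [appearsInRow_predTableau, hsucc, hR.bot_iff, Fin.exists_fin_succ]
      simp [hR0 i.succ (Fin.succ_ne_zero i)]
    · rw [appearsInRow_predTableau]
      exact iff_of_false (hlast 1) (happ 0)
  · intro v
    rw [has]
    exact iff_of_false (not_movesUp_of_notMem hT) fun h => hR0 v h.1 h.2

end Tableau

/-! ### The rows after one `K`-gromotion -/

section NewRows
variable {c q r s : ℕ} {x y : ℕ → ℕ}

lemma newTop_strictMono (h : IsRows c q x y) (ht : IsTurn x y r s) :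
    StrictMono (newTop x y s) := by
  refine strictMono_nat_of_lt_succ fun j => ?_
  have h1 := h.xmono (Nat.lt_add_one j)
  have h2 := h.xmono (Nat.lt_add_one (j + 1))
  have h3 := h.lt (j + 1)
  have h4 := ht.at_s
  rcases lt_trichotomy j s with hj | rfl | hj
  · unfold newTop
    split_ifs <;> omega
  · simpa [newTop] using h4
  · unfold newTop
    split_ifs <;> omega

lemma newBot_strictMono (h : IsRows c q x y) : StrictMono (newBot y r) := by
  refine strictMono_nat_of_lt_succ fun j => ?_
  have h1 := h.ymono (Nat.lt_add_one j)
  have h2 := h.ymono (Nat.lt_add_one (j + 1))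
  unfold newBot
  split_ifs <;> omega

lemma newTop_lt_newBot (h : IsRows c q x y) (ht : IsTurn x y r s) (j : ℕ) :
    newTop x y s j < newBot y r j := by
  have h1 := h.ymono (Nat.lt_add_one j)
  have h2 := h.lt j
  have h3 := h.lt (j + 1)
  have h4 := ht.before_r j
  have h5 := ht.le
  unfold newTop newBot
  split_ifs <;> omega

lemma newTop_le (h : IsRows c q x y) (ht : IsTurn x y r s) (j : ℕ) : newTop x y s j ≤ y j := by
  have h2 := h.lt j
  have h3 := ht.before_s j
  unfold newTop
  split_ifs <;> omega

lemma newTop_eq_iff {v : ℕ} :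
    (∃ j, newTop x y s j = v) ↔
      (∃ j, 0 < j ∧ x j = v) ∨ ∃ j, newTop x y s j = v ∧ y j = v := by
  constructor
  · rintro ⟨j, hj⟩
    rcases lt_trichotomy j s with h1 | h1 | h1
    · exact Or.inl ⟨j + 1, by omega, by rwa [newTop, if_pos h1] at hj⟩
    · refine Or.inr ⟨j, hj, ?_⟩
      rwa [newTop, if_neg (by omega), if_pos h1] at hj
    · exact Or.inl ⟨j, by omega, by rwa [newTop, if_neg (by omega), if_neg (by omega)] at hj⟩
  · rintro (⟨j, hj, rfl⟩ | ⟨j, hj, -⟩)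
    · by_cases h1 : j ≤ s
      · refine ⟨j - 1, ?_⟩
        rw [newTop, if_pos (by omega), Nat.sub_add_cancel hj]
      · exact ⟨j, by rw [newTop, if_neg (by omega), if_neg (by omega)]⟩
    · exact ⟨j, hj⟩

lemma newBot_eq_iff {v : ℕ} : (∃ j, newBot y r j = v) ↔ ∃ j, j ≠ r ∧ y j = v := by
  constructor
  · rintro ⟨j, hj⟩
    unfold newBot at hj
    split_ifs at hj with h1
    · exact ⟨j, h1.ne, hj⟩
    · exact ⟨j + 1, by omega, hj⟩
  · rintro ⟨j, hj, rfl⟩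
    rcases lt_or_gt_of_ne hj with h1 | h1
    · exact ⟨j, if_pos h1⟩
    · refine ⟨j - 1, ?_⟩
      rw [newBot, if_neg (by omega), Nat.sub_add_cancel (by omega)]

/-- With `newTop_turn` this makes `y r`, the only letter that leaves the bottom row, the least
letter that moves up. -/
lemma le_of_newTop_eq (ht : IsTurn x y r s) {j : ℕ} (hj : newTop x y s j = y j) : r ≤ j := by
  by_contra! h1
  have h2 := ht.before_r j h1
  have h3 := ht.le
  rw [newTop, if_pos (by omega)] at hj
  omega

lemma newTop_turn (ht : IsTurn x y r s) : newTop x y s r = y r := by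
  have h1 := ht.at_r
  have h2 := ht.before_s r
  have h3 := ht.le
  unfold newTop
  split_ifs <;> omega

end NewRows

/-! ### Rotation of the relation and the promotion digraph -/

section Step
variable {c n : ℕ}

/-- The effect of one `K`-gromotion, with the alphabet renamed to `0 < ⋯ < n` again, on a tableau in
which the least letter appears. -/
lemma gromotion_step_of_mem (T : IncTableau 2 c (n + 1))
    {R : Fin (n + 1) → Fin (n + 1) → Prop}
    (hR : IsNoncrossingRel (AppearsInRow T 0) (AppearsInRow T 1) R) (h0 : extendRow T 0 0 = 0) :
    ∃ T' : IncTableau 2 c (n + 1),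
      (∀ b, gromotion (List.finRange (n + 1)) T.entry b = T'.entry b + 1) ∧
      IsNoncrossingRel (AppearsInRow T' 0) (AppearsInRow T' 1) (fun u v => R (u + 1) (v + 1)) ∧
      ∀ v, MovesUp (List.finRange (n + 1)) T.entry 1 v ↔ v ≠ 0 ∧ R 0 v := by
  have h := isRows_extendRow T
  have hc : 0 < c := by
    by_contra! hc
    have := h.x_ge 0 hc
    omega
  obtain ⟨r, s, ht⟩ := IsTurn.exists h hc
  have hmem := fun v : Fin (n + 1) => rel_zero_iff (v := v) hR ht h0
  have hentry := ofRows_extendRow T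
  have happ := fun i v => appearsInRow_iff (T := T) (i := i) (v := v)
  set x := extendRow T 0
  set y := extendRow T 1
  have hX := newTop_strictMono h ht
  have hY := newBot_strictMono (r := r) h
  have hXY := newTop_lt_newBot h ht
  have hXlt : ∀ j, j < c → newTop x y s j < n + 1 := fun j hj =>
    (newTop_le h ht j).trans_lt (h.y_lt j hj)
  have hYlt : ∀ j, j + 1 < c → newBot y r j < n + 1 := fun j hj => by
    have h1 := h.y_lt (j + 1) hj
    have h2 := h.y_lt j (by omega)
    unfold newBot
    split_ifs <;> assumption
  -- The letter `0` is now the greatest of the alphabet, so it is represented by `n + 1`, to which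
  -- the values of the continued rows are cut down; modulo `n + 1` it becomes `0` again.
  let g : Box 2 c → ℕ := fun b => min (ofRows c (newTop x y s) (newBot y r) b) (n + 1)
  have hg0 : ∀ j, g (0, j) = newTop x y s j := fun j => by
    have := hXlt j j.2
    simp only [g, ofRows_zero]
    omega
  have hg1 : ∀ j, g (1, j) = min (newBot y r j) (n + 1) := fun j => by
    simp only [g, ofRows_one]
  have hgpos : ∀ b, 0 < g b := by
    rintro ⟨i, j⟩
    fin_cases i
    · exact (hg0 j).symm ▸ newTop_pos h j
    · exact (hg1 j).symm ▸ lt_min (newBot_pos h j) n.succ_pos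
  refine ⟨predTableau g hgpos (fun b => min_le_right _ _) ?_ ?_, ?_, ?_, ?_⟩
  · intro i j j' hj
    fin_cases i
    · simpa only [Fin.zero_eta, hg0] using hX hj
    · simp only [Fin.mk_one, hg1]
      have h1 := hY (show j.val < j'.val from hj)
      have h2 := hYlt j (by omega)
      omega
  · intro i i' j hi
    obtain ⟨rfl, rfl⟩ : i = 0 ∧ i' = 1 := by omega
    rw [hg0, hg1]
    exact lt_min (hXY j) (hXlt j j.2)
  · intro b
    ext
    rw [predTableau_entry_add_one, ← gromotion_map Fin.val_injective, map_val_finRange, ← hentry,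
      gromotion_twoRows h ht h0 n.succ_pos]
    simp only [g]
    split_ifs with h1
    · rw [min_eq_left h1.le, Nat.mod_eq_of_lt h1]
    · rw [min_eq_right (not_lt.1 h1), Nat.mod_self]
  · apply hR.shift
    · intro i
      have h1 : AppearsInRow T 0 i.succ ↔ ∃ j, 0 < j ∧ x j = i.succ.val := by
        rw [happ]
        refine exists_congr fun j => ⟨fun hj => ⟨?_, hj⟩, And.right⟩
        by_contra! hj0
        obtain rfl : j = 0 := by omega
        exact absurd (h0.symm.trans hj) (by simp)
      rw [appearsInRow_predTableau, h1, hmem _ (Fin.succ_ne_zero i), ← newTop_eq_iff]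
      simp only [hg0, Fin.val_castSucc, Fin.val_succ]
      refine ⟨fun ⟨j, hj⟩ => ⟨j, hj⟩, fun ⟨j, hj⟩ => ?_⟩
      have hjc : j < c := by
        by_contra! hjc
        have h1 := h.x_ge j hjc
        have h2 := le_newTop (s := s) h j
        omega
      exact ⟨⟨j, hjc⟩, hj⟩
    · rw [appearsInRow_predTableau]
      rintro ⟨j, hj⟩
      have := hXlt j j.2
      rw [hg0, Fin.val_last] at hj
      omega
    · intro i
      have h1 : (∃ j, g (1, j) = i.castSucc.val + 1) ↔ ∃ j, j ≠ r ∧ y j = i.succ.val := by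
        rw [← newBot_eq_iff]
        simp only [hg1, Fin.val_castSucc, Fin.val_succ]
        refine ⟨fun ⟨j, hj⟩ => ⟨j, by omega⟩, fun ⟨j, hj⟩ => ?_⟩
        have hjc : j < c := by
          by_contra! hjc
          have h1 := h.x_ge j hjc
          have h2 := h.lt j
          have h3 := le_newBot (r := r) h j
          omega
        exact ⟨⟨j, hjc⟩, by simp only; omega⟩
      rw [appearsInRow_predTableau, h1]
      constructor
      · rintro ⟨j, hjr, hj⟩
        obtain ⟨w, hw, hRw⟩ := (hR.bot_iff _).1 ((happ 1 i.succ).2 ⟨j, hj⟩)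
        induction w using Fin.cases with
        | succ k => exact ⟨k, Fin.succ_lt_succ_iff.1 hw, hRw⟩
        -- If the smaller element found is `0`, then `y r` replaces it: it is in the class of `0`
        -- and smaller than `y j`, as `j ≠ r`.
        | zero =>
          obtain ⟨j', h2, h3⟩ := (hmem _ (Fin.succ_ne_zero i)).1 hRw
          obtain rfl : j' = j := h.ymono.injective (h3.trans hj.symm)
          have h4 := le_of_newTop_eq ht (h2.trans h3.symm)
          have h5 := h.ymono (lt_of_le_of_ne h4 hjr.symm)
          have h6 := h.lt r
          rw [hj, Fin.val_succ] at h5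
          let k : Fin n := ⟨y r - 1, by omega⟩
          have hk : k.succ.val = y r := by simp only [k, Fin.val_succ]; omega
          refine ⟨k, Fin.lt_def.2 (by simp only [k]; omega), ?_⟩
          exact hR.equiv.trans (hR.equiv.symm ((hmem k.succ (Fin.succ_ne_zero k)).2
            ⟨r, (newTop_turn ht).trans hk.symm, hk.symm⟩)) hRw
      · rintro ⟨k, hki, hRk⟩
        obtain ⟨j, hj : y j = i.succ.val⟩ := (happ 1 i.succ).1
          ((hR.bot_iff _).2 ⟨_, Fin.succ_lt_succ_iff.2 hki, hRk⟩)
        refine ⟨j, ?_, hj⟩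
        -- The letter `y r` is the least nonzero element of the class of `0`, so no `k.succ` below
        -- it can be related to it.
        rintro rfl
        have h2 := (hmem _ (Fin.succ_ne_zero i)).2 ⟨j, (newTop_turn ht).trans hj, hj⟩
        obtain ⟨j', h3, h4⟩ := (hmem _ (Fin.succ_ne_zero k)).1
          (hR.equiv.trans h2 (hR.equiv.symm hRk))
        have h5 := le_of_newTop_eq ht (h3.trans h4.symm)
        have h6 := h.ymono.monotone h5
        rw [hj, h4] at h6
        exact absurd (Fin.succ_lt_succ_iff.2 hki) (not_lt.2 h6)
    · rw [appearsInRow_predTableau]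
      -- The last bottom box is due to receive `y c`, which is beyond the alphabet and cut down to
      -- `n + 1`.
      refine iff_of_true ⟨⟨c - 1, by omega⟩, ?_⟩ ((happ 0 0).2 ⟨0, h0⟩)
      have h1 := ht.lt h hc
      have h2 := ht.le
      have h3 := h.x_ge c le_rfl
      have h4 := h.lt c
      rw [hg1, newBot, if_neg (by simp only; omega), Fin.val_last]
      simp only [Nat.sub_add_cancel hc]
      omega
  · intro v
    rw [← movesUp_map_iff Fin.val_injective, map_val_finRange, ← hentry,
      movesUp_twoRows_iff h ht h0 n.succ_pos]
    constructor
    · rintro ⟨-, j, h1, h2⟩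
      have hv : v ≠ 0 := by
        rintro rfl
        have := newTop_pos (s := s) h j
        rw [h1, Fin.val_zero] at this
        omega
      exact ⟨hv, (hmem v hv).2 ⟨j, h1, h2⟩⟩
    · rintro ⟨hv, h1⟩
      exact ⟨v.2, (hmem v hv).1 h1⟩

lemma gromotion_step (T : IncTableau 2 c (n + 1)) {R : Fin (n + 1) → Fin (n + 1) → Prop}
    (hR : IsNoncrossingRel (AppearsInRow T 0) (AppearsInRow T 1) R) :
    ∃ T' : IncTableau 2 c (n + 1),
      (∀ b, gromotion (List.finRange (n + 1)) T.entry b = T'.entry b + 1) ∧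
      IsNoncrossingRel (AppearsInRow T' 0) (AppearsInRow T' 1) (fun u v => R (u + 1) (v + 1)) ∧
      ∀ v, MovesUp (List.finRange (n + 1)) T.entry 1 v ↔ v ≠ 0 ∧ R 0 v := by
  by_cases h0 : extendRow T 0 0 = 0
  · exact gromotion_step_of_mem T hR h0
  -- The letter `0` can occur only in the top left corner.
  · refine gromotion_step_of_notMem T hR ?_
    rintro ⟨i, j⟩ hb
    have h := isRows_extendRow T
    obtain ⟨k, hk⟩ := appearsInRow_iff.1 (⟨j, hb⟩ : AppearsInRow T i 0)
    have h1 := h.xmono.monotone (Nat.zero_le k)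
    have h2 := h.lt k
    rw [Fin.val_zero] at hk
    fin_cases i
    · simp only [Fin.zero_eta] at hk; omega
    · simp only [Fin.mk_one] at hk; omega

/-- Up to renaming letters, the iterates of `K`-gromotion are tableaux whose noncrossing relations
are the rotations of the one of `T`. -/
lemma gromotionIter_eq (T : IncTableau 2 c (n + 1)) {R : Fin (n + 1) → Fin (n + 1) → Prop}
    (hR : IsNoncrossingRel (AppearsInRow T 0) (AppearsInRow T 1) R) (k : ℕ) :
    ∃ T' : IncTableau 2 c (n + 1),
      gromotionIter T k = (fun b => T'.entry b + Fin.ofNat (n + 1) k) ∧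
      IsNoncrossingRel (AppearsInRow T' 0) (AppearsInRow T' 1)
        (fun u v => R (u + Fin.ofNat (n + 1) k) (v + Fin.ofNat (n + 1) k)) := by
  induction k with
  | zero =>
    have h0 : Fin.ofNat (n + 1) 0 = 0 := rfl
    simp only [h0, add_zero]
    exact ⟨T, rfl, hR⟩
  | succ k ih =>
    obtain ⟨T₁, h1, h2⟩ := ih
    obtain ⟨T₂, h3, h4, -⟩ := gromotion_step T₁ h2
    have hk : ∀ v : Fin (n + 1), v + Fin.ofNat (n + 1) (k + 1) = v + 1 + Fin.ofNat (n + 1) k := by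
      intro v
      rw [add_assoc]
      congr 1
      ext
      simp [Fin.val_add, Nat.add_comm]
    refine ⟨T₂, ?_, ?_⟩
    · funext b
      rw [gromotionIter, h1, alphabet_eq_map, gromotion_map (add_left_injective _), h3, hk]
    · simpa only [hk] using h4

/-- Subtracting `u` turns an arrow `u → v` into a move of the letter `v - u` in the first
`K`-gromotion of the renamed iterate, whose relation is `R` translated by `u`. -/
lemma prom_adj_iff (T : IncTableau 2 c (n + 1)) {R : Fin (n + 1) → Fin (n + 1) → Prop}
    (hR : IsNoncrossingRel (AppearsInRow T 0) (AppearsInRow T 1) R) (u v : Fin (n + 1)) :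
    (prom 1 T).Adj u v ↔ u ≠ v ∧ R u v := by
  obtain ⟨T', h1, h2⟩ := gromotionIter_eq T hR u.val
  obtain ⟨-, -, -, h3⟩ := gromotion_step T' h2
  have h4 := h3 (v - u)
  have hu : Fin.ofNat (n + 1) u.val = u := by ext; simp
  rw [← movesUp_map_iff (add_left_injective (Fin.ofNat (n + 1) u.val)), ← alphabet_eq_map, hu,
    zero_add, sub_add_cancel, sub_ne_zero, ne_comm] at h4
  rw [hu] at h1
  change MovesUp (alphabet (n + 1) u.val) (gromotionIter T u.val) 1 v ↔ _
  rwa [h1]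

end Step

end KPromotion

/-! ### The theorem -/

theorem mainTheorem4 (c q : ℕ) (T : KPromotion.IncTableau 2 c q) :
    (∃! π : Finpartition (Finset.univ : Finset (Fin q)), KPromotion.IsPartitionOf T π) ∧
    ∀ π : Finpartition (Finset.univ : Finset (Fin q)), KPromotion.IsPartitionOf T π →
      KPromotion.prom 1 T = ⨆ B ∈ π.parts, KPromotion.completeOn B := by
  open KPromotion in
  refine ⟨?_, fun π hπ => ?_⟩
  · obtain ⟨R, hR⟩ := exists_isNoncrossingRel T
    obtain ⟨π, hπ⟩ := exists_sameBlock_iff hR.equiv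
    refine ⟨π, isPartitionOf_iff.2 ?_, fun π' hπ' => eq_of_sameBlock_iff fun u v => ?_⟩
    · obtain rfl : SameBlock π = R := funext₂ fun u v => propext (hπ u v)
      exact hR
    · rw [hπ]
      exact (isPartitionOf_iff.1 hπ').rel_iff hR
  -- Renaming letters is arithmetic modulo `q = n + 1`; for `q = 0` there are no vertices.
  · obtain _ | n := q
    · ext u
      exact u.elim0
    · ext u v
      rw [prom_adj_iff T (isPartitionOf_iff.1 hπ)]
      simp only [Digraph.iSup_adj, completeOn, SameBlock]
      constructor
      · rintro ⟨hne, B, hB, hu, hv⟩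
        exact ⟨B, hB, hu, hv, hne⟩
      · rintro ⟨B, hB, hu, hv, hne⟩
        exact ⟨hne, B, hB, hu, hv⟩
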